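/- Let $q\ge2$. A Pólya urn with colours $1,\dots,q$ is given by activities $a_1,\dots,a_q\ge0$, a nonrandom initial state $X_0\in\mathbb R^q$, and random replacement vectors $\xi_i=(\xi_{i1},\dots,\xi_{iq})\in\mathbb R^q$, $i=1,\dots,q$. At each step $n\ge0$, given the past, a colour $i$ is drawn with probability $a_iX_{ni}/\sum_j a_jX_{nj}$, and then $X_{n+1}=X_n+\Delta X_n$, where, given the past and the drawn colour $i$, $\Delta X_n$ has the distribution of $\xi_i$. Assume that the urn is tenable (for every $n\ge 0$, a.s. all $X_{ni}\ge0$ and $\sum_i a_iX_{ni}>0$) and balanced (there is a constant $b>0$ such that $\sum_j a_j\xi_{ij}=b$ a.s. for every $i$), and that $\mathbb E|\xi_{ij}|^p<\infty$ for all $i,j$ and all $p\ge1$. Let $A=(a_j\mathbb E\xi_{ji})_{i,j=1}^q$. For an eigenvalue $\lambda$ of $A$, let $\nu_\lambda+1$ be the size of the largest Jordan block of $A$ with eigenvalue $\lambda$. List the eigenvalues of $A$ with algebraic multiplicity as $\lambda_1,\dots,\lambda_q$ so that $\operatorname{Re}\lambda_1\ge\operatorname{Re}\lambda_2\ge\cdots$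 and, among eigenvalues with equal real parts, in order of decreasing $\nu_j:=\nu_{\lambda_j}$; assume that $\lambda_1=b$. (i) If $\operatorname{Re}\lambda_2<\lambda_1/2$ and, as $n\to\infty$, $$\frac{X_n-\mathbb EX_n}{\sqrt n}\xrightarrow{d}N(0,\Sigma)$$ for some (covariance) matrix $\Sigma$, then this holds with convergence of all moments, ordinary (including mixed) and absolute, to the corresponding moments of $N(0,\Sigma)$. In particular, $\operatorname{Cov}[X_n]/n\to\Sigma$. (ii) If $\operatorname{Re}\lambda_2=\lambda_1/2$ and, as $n\to\infty$, $$\frac{X_n-\mathbb EX_n}{\sqrt{n(\log n)^{2\nu_2+1}}}\xrightarrow{d}N(0,\Sigma)$$ for some (covariance) matrix $\Sigma$, then this holds with convergence of all moments, ordinary (including mixed) and absolute, to the corresponding moments of $N(0,\Sigma)$. In particular, $\operatorname{Cov}[X_n]/\bigl(n(\log n)^{2\nu_2+1}\bigr)\to\Sigma$. -/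

import Mathlib

open MeasureTheory ProbabilityTheory Filter Topology

/-- The data of a generalized Pólya urn with `q` colours: the activities `a_i ≥ 0`, the nonrandom
initial state `X_0`, and, for each colour `i`, the law of the random replacement vector `ξ_i`. -/
structure PolyaUrn (q : ℕ) where
  activity : Fin q → ℝ
  activity_nonneg : ∀ i, 0 ≤ activity i
  init : EuclideanSpace ℝ (Fin q)
  repl : Fin q → Measure (EuclideanSpace ℝ (Fin q))
  isProbabilityMeasure_repl : ∀ i, IsProbabilityMeasure (repl i)

/-- The information available after `n` draws: the σ-field generated by `X_0, …, X_n` and by the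
colours `I_0, …, I_{n-1}` of the balls drawn so far. -/
abbrev urnPast {q : ℕ} {Ω : Type*} (X : ℕ → Ω → EuclideanSpace ℝ (Fin q)) (I : ℕ → Ω → Fin q)
    (n : ℕ) : MeasurableSpace Ω :=
  (⨆ k ≤ n, MeasurableSpace.comap (X k) inferInstance) ⊔
    (⨆ k < n, MeasurableSpace.comap (I k) inferInstance)

namespace PolyaUrn

variable {q : ℕ}

/-- `X` is a realization on `(Ω, P)` of the Pólya urn with data `U`, where `I n` is the colour of the ball drawn when
the urn passes from state `X n` to state `X (n + 1)`. -/
structure IsRealization (U : PolyaUrn q) {Ω : Type*} [MeasurableSpace Ω] (P : Measure Ω)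
    (X : ℕ → Ω → EuclideanSpace ℝ (Fin q)) (I : ℕ → Ω → Fin q) : Prop where
  measurable_state : ∀ n, Measurable (X n)
  measurable_draw : ∀ n, Measurable (I n)
  /-- The urn starts in the given state. -/
  start : ∀ᵐ ω ∂P, X 0 ω = U.init
  /-- Given the past, colour `i` is drawn with probability `a_i X_{ni} / ∑_j a_j X_{nj}`. -/
  draw : ∀ n i, P⟦{ω | I n ω = i} | urnPast X I n⟧ =ᵐ[P]
    fun ω => U.activity i * X n ω i / ∑ j, U.activity j * X n ω j
  /-- Given the past and the colour `i` drawn, the increment `X_{n+1} - X_n` has the law of `ξ_i`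
  (so it depends on the past only through the colour drawn). -/
  replace : ∀ n (B : Set (EuclideanSpace ℝ (Fin q))), MeasurableSet B →
    P⟦{ω | X (n + 1) ω - X n ω ∈ B} | urnPast X I n ⊔ MeasurableSpace.comap (I n) inferInstance⟧
      =ᵐ[P] fun ω => (U.repl (I n ω)).real B

/-- Tenability: at every time, almost surely, all coordinates of the state are nonnegative and the
total activity in the urn is positive. -/
def IsTenable (U : PolyaUrn q) {Ω : Type*} [MeasurableSpace Ω] (P : Measure Ω)
    (X : ℕ → Ω → EuclideanSpace ℝ (Fin q)) : Prop :=
  ∀ n, ∀ᵐ ω ∂P, (∀ i, 0 ≤ X n ω i) ∧ 0 < ∑ i, U.activity i * X n ω i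

/-- The urn is balanced with (positive) balance `b`: `∑_j a_j ξ_{ij} = b` a.s. for every `i`. -/
def IsBalanced (U : PolyaUrn q) (b : ℝ) : Prop :=
  0 < b ∧ ∀ i, ∀ᵐ v ∂(U.repl i), ∑ j, U.activity j * v j = b

/-- `E|ξ_{ij}|^p < ∞` for all `i, j` and all real `p ≥ 1`. -/
def HasAllMoments (U : PolyaUrn q) : Prop :=
  ∀ p : ℝ, 1 ≤ p → ∀ i j, Integrable (fun v : EuclideanSpace ℝ (Fin q) => |v j| ^ p) (U.repl i)

/-- The intensity matrix, with entries `A_{ij} = a_j E ξ_{ji}`. -/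
noncomputable def intensity (U : PolyaUrn q) : Matrix (Fin q) (Fin q) ℝ :=
  Matrix.of fun i j => U.activity j * ∫ v, v i ∂(U.repl j)

/-- The intensity matrix regarded as a complex matrix. -/
noncomputable def intensityC (U : PolyaUrn q) : Matrix (Fin q) (Fin q) ℂ :=
  U.intensity.map Complex.ofReal

end PolyaUrn

/-- For an eigenvalue `lam` of `M`, the integer `ν_lam`: the least `k` such that
`(M - lam)^(k+1)` vanishes on the generalized eigenspace of `lam`, so that the nilpotent part `N`
of `M` at `lam` satisfies `N^(k+1) = 0`, and the largest Jordan block for `lam` has size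
`k + 1`. -/
noncomputable def jordanIndex {q : ℕ} (M : Matrix (Fin q) (Fin q) ℂ) (lam : ℂ) : ℕ :=
  sInf {k : ℕ | ∀ v ∈ Module.End.maxGenEigenspace (Matrix.toLin' M) lam,
    ((Matrix.toLin' M - lam • (1 : Module.End ℂ (Fin q → ℂ))) ^ (k + 1)) v = 0}

/-- `ev` lists the eigenvalues of `M`, repeated according to algebraic multiplicity, by decreasing
real part, and by decreasing `ν` among eigenvalues with the same real part. -/
structure IsEigenvalueList {q : ℕ} (M : Matrix (Fin q) (Fin q) ℂ) (ev : Fin q → ℂ) : Prop where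
  roots_eq : M.charpoly.roots = Finset.univ.val.map ev
  re_antitone : ∀ i j, i ≤ j → (ev j).re ≤ (ev i).re
  index_antitone : ∀ i j, i ≤ j → (ev i).re = (ev j).re →
    jordanIndex M (ev j) ≤ jordanIndex M (ev i)

/-- The centred and normalized sequence `(X_n - E X_n) / c_n`. -/
noncomputable def normalized {q : ℕ} {Ω : Type*} [MeasurableSpace Ω] (P : Measure Ω)
    (X : ℕ → Ω → EuclideanSpace ℝ (Fin q)) (c : ℕ → ℝ) (n : ℕ) (ω : Ω) :
    EuclideanSpace ℝ (Fin q) :=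
  (c n)⁻¹ • (X n ω - ∫ ω', X n ω' ∂P)

/-- The covariance matrix of a random vector. -/
noncomputable def covMatrix {q : ℕ} {Ω : Type*} [MeasurableSpace Ω] (P : Measure Ω)
    (Y : Ω → EuclideanSpace ℝ (Fin q)) : Matrix (Fin q) (Fin q) ℝ :=
  Matrix.of fun i j => cov[fun ω => Y ω i, fun ω => Y ω j; P]

/-- `E f(Z_n) → E f(Z)` where `Z` has law `γ`, all these expectations being finite. -/
def ExpectationConverges {q : ℕ} {Ω : Type*} [MeasurableSpace Ω] (P : Measure Ω)
    (Z : ℕ → Ω → EuclideanSpace ℝ (Fin q)) (γ : Measure (EuclideanSpace ℝ (Fin q)))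
    (f : EuclideanSpace ℝ (Fin q) → ℝ) : Prop :=
  (∀ n, Integrable (fun ω => f (Z n ω)) P) ∧ Integrable f γ ∧
    Tendsto (fun n => ∫ ω, f (Z n ω) ∂P) atTop (𝓝 (∫ z, f z ∂γ))

/-- Convergence of all moments of `Z_n` to those of `γ`: ordinary mixed moments, absolute mixed
moments of all real orders, and moments of the Euclidean norm of all real orders. -/
structure AllMomentsConverge {q : ℕ} {Ω : Type*} [MeasurableSpace Ω] (P : Measure Ω)
    (Z : ℕ → Ω → EuclideanSpace ℝ (Fin q)) (γ : Measure (EuclideanSpace ℝ (Fin q))) : Prop where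
  ordinary : ∀ α : Fin q → ℕ, ExpectationConverges P Z γ fun z => ∏ i, z i ^ α i
  absolute : ∀ r : Fin q → ℝ, (∀ i, 0 ≤ r i) →
    ExpectationConverges P Z γ fun z => ∏ i, |z i| ^ r i
  norm : ∀ p : ℝ, 0 ≤ p → ExpectationConverges P Z γ fun z => ‖z‖ ^ p

/-! Convergence in distribution gives convergence of moments once every even moment of the
normalized vectors is bounded in `n`; so everything reduces to bounding the centred even moments of
`X n`.

Balance makes the total activity `w n` deterministic, so the conditional mean of the next state is
linear: `X (n+1) = (1 + A / w n) X n + noise n`. Unrolling, `X n` is a deterministic vector (its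
mean) plus the sum over `k < n` of noise `k` multiplied by the product of `1 + A / w j` over `k < j
< n` (`ae_state_eq`). For fixed `n` the coordinates of these summands are martingale differences in
`k`. A Burkholder type inequality (`exists_integral_sum_pow_le`) bounds their even moments by powers
of a total variance, provided the noise has moments bounded uniformly in time
(`exists_integral_noise_pow_le`).

The variance is controlled by the spectrum. The activities form a left eigenvector of `A` for `b`,
and increments and drift both have activity exactly `b`; so the noise lies in the hyperplane
annihilated by the activities. When `Re λ₂ ≤ b / 2` the eigenvalue `b` is simple, and that
hyperplane is spanned by the other generalized eigenspaces
(`exists_norm_evolve_le_of_dual_eq_zero`). On the one for `z`, the product grows like `exp (Re z *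
T) (1 + T) ^ ν`, where `T` is the sum of the `1 / w j`, at most `log (w n / w k) / b`; nonnegative
upper rates suffice here. Squaring and summing over `k` gives `O(n)` if `Re λ₂ < b / 2`. At equality
the summands are of order `(n / k) (log n) ^ (2ν)`, and the sum over `1 / k` contributes the
additional logarithm. -/

/-! ### Even moments of sums of martingale differences. -/

/-- Second order Taylor bound for powers. -/
theorem abs_add_pow_sub_le (n : ℕ) : ∃ C : ℝ, 0 < C ∧ ∀ x y : ℝ,
    |(x + y) ^ (n + 2) - x ^ (n + 2) - (n + 2) * x ^ (n + 1) * y| ≤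
      C * (y ^ 2 * max |x| |y| ^ n) := by
  induction n with
  | zero =>
    refine ⟨1, one_pos, fun x y => le_of_eq ?_⟩
    have : (x + y) ^ (0 + 2) - x ^ (0 + 2) - ((0 : ℕ) + 2) * x ^ (0 + 1) * y = y ^ 2 := by
      push_cast; ring
    rw [this, abs_of_nonneg (sq_nonneg y)]; simp
  | succ n ih =>
    obtain ⟨C, hC, h⟩ := ih
    refine ⟨2 * C + (n + 2), by positivity, fun x y => ?_⟩
    set M := max |x| |y|
    have hM : 0 ≤ M := le_max_of_le_left (abs_nonneg x)
    have hx : |x| ≤ M := le_max_left _ _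
    have hxy : |x + y| ≤ 2 * M := (abs_add_le x y).trans (by linarith [le_max_right |x| |y|])
    have e : (x + y) ^ (n + 1 + 2) - x ^ (n + 1 + 2) - ((n + 1 : ℕ) + 2) * x ^ (n + 1 + 1) * y =
        ((x + y) ^ (n + 2) - x ^ (n + 2) - (n + 2) * x ^ (n + 1) * y) * (x + y) +
          (n + 2) * (x ^ (n + 1) * y ^ 2) := by push_cast; ring
    rw [e]
    refine (abs_add_le _ _).trans ?_
    rw [abs_mul, abs_mul, abs_mul, abs_pow x, abs_of_nonneg (sq_nonneg y),
      abs_of_nonneg (by positivity : (0 : ℝ) ≤ n + 2)]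
    calc _ ≤ C * (y ^ 2 * M ^ n) * (2 * M) + (n + 2) * (M ^ (n + 1) * y ^ 2) := by
          gcongr
          exact h x y
      _ = _ := by ring

/-- Even powers of a sum, up to an error of second order. -/
theorem add_pow_even_le (s : ℕ) : ∃ C : ℝ, 0 < C ∧ ∀ x y : ℝ,
    (x + y) ^ (2 * s + 2) ≤ x ^ (2 * s + 2) + (2 * s + 2) * (x ^ (2 * s + 1) * y) +
      C * (x ^ (2 * s) * y ^ 2 + y ^ (2 * s + 2)) := by
  obtain ⟨C, hC, h⟩ := abs_add_pow_sub_le (2 * s)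
  refine ⟨C, hC, fun x y => ?_⟩
  have h1 := (abs_le.1 (h x y)).2
  have h2 : max |x| |y| ^ (2 * s) ≤ x ^ (2 * s) + y ^ (2 * s) := by
    have hx : |x| ^ (2 * s) = x ^ (2 * s) := (even_two_mul s).pow_abs x
    have hy : |y| ^ (2 * s) = y ^ (2 * s) := (even_two_mul s).pow_abs y
    have px := (even_two_mul s).pow_nonneg x
    have py := (even_two_mul s).pow_nonneg y
    rcases max_cases |x| |y| with ⟨e, -⟩ | ⟨e, -⟩ <;> rw [e] <;> linarith
  have h3 : C * (y ^ 2 * max |x| |y| ^ (2 * s)) ≤ C * (x ^ (2 * s) * y ^ 2 + y ^ (2 * s + 2)) := by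
    calc _ ≤ C * (y ^ 2 * (x ^ (2 * s) + y ^ (2 * s))) := by gcongr
      _ = _ := by ring
  push_cast at h1
  nlinarith

/-- A weighted form of Young's inequality. -/
theorem pow_mul_sq_le (s : ℕ) {t : ℝ} (ht : 0 < t) (x y : ℝ) :
    x ^ (2 * s) * y ^ 2 ≤ t * x ^ (2 * s + 2) + (1 / t) ^ s * y ^ (2 * s + 2) := by
  have e1 : x ^ (2 * s + 2) = x ^ (2 * s) * x ^ 2 := by ring
  have e2 : y ^ (2 * s + 2) = (y ^ 2) ^ s * y ^ 2 := by ring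
  have px := (even_two_mul s).pow_nonneg x
  rw [e1, e2]
  -- Whichever of `y ^ 2` and `t * x ^ 2` is larger, one of the two terms on the right alone
  -- suffices.
  rcases le_total (y ^ 2) (t * x ^ 2) with h | h
  · have : x ^ (2 * s) * y ^ 2 ≤ x ^ (2 * s) * (t * x ^ 2) := by gcongr
    have h2 : 0 ≤ (1 / t) ^ s * ((y ^ 2) ^ s * y ^ 2) := by positivity
    nlinarith
  · have h1 : x ^ 2 ≤ 1 / t * y ^ 2 := by
      rw [div_mul_eq_mul_div, one_mul, le_div_iff₀ ht]; linarith
    have h2 : x ^ (2 * s) ≤ (1 / t) ^ s * (y ^ 2) ^ s := by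
      rw [pow_mul, ← mul_pow]; gcongr
    have h3 : 0 ≤ t * (x ^ (2 * s) * x ^ 2) := by positivity
    nlinarith [mul_le_mul_of_nonneg_right h2 (sq_nonneg y)]

section

variable {Ω : Type*} [MeasurableSpace Ω] {P : Measure Ω}

theorem MeasureTheory.MemLp.integrable_pow_mul_pow {f g : Ω → ℝ} {n a b : ℕ} (hn : a + b = n)
    (h0 : n ≠ 0) (hf : MemLp f n P) (hg : MemLp g n P) :
    Integrable (fun ω => f ω ^ a * g ω ^ b) P := by
  have hf' := hf.integrable_norm_pow h0
  have hg' := hg.integrable_norm_pow h0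
  refine (hf'.add hg').mono' ((hf.1.pow a).mul (hg.1.pow b)) (.of_forall fun ω => ?_)
  simp only [norm_mul, norm_pow, Pi.add_apply]
  have : ‖f ω‖ ^ a * ‖g ω‖ ^ b ≤ max ‖f ω‖ ‖g ω‖ ^ n := by
    rw [← hn, pow_add]
    gcongr
    · exact le_max_left _ _
    · exact le_max_right _ _
  refine this.trans ?_
  rcases max_cases ‖f ω‖ ‖g ω‖ with ⟨e, -⟩ | ⟨e, -⟩ <;> rw [e]
  · linarith [pow_nonneg (norm_nonneg (g ω)) n]
  · linarith [pow_nonneg (norm_nonneg (f ω)) n]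

/-- A Burkholder type bound for even moments of sums of martingale differences. -/
theorem exists_integral_sum_pow_le [IsProbabilityMeasure P] (s : ℕ) {D : ℝ} (hD : 0 ≤ D) :
    ∃ K : ℝ, 0 ≤ K ∧ ∀ (n : ℕ) (d : ℕ → Ω → ℝ) (c V : ℕ → ℝ),
      (∀ k < n, MemLp (d k) (2 * s + 2 : ℕ) P) →
      (∀ k < n, ∫ ω, (∑ j ∈ Finset.range k, d j ω) ^ (2 * s + 1) * d k ω ∂P = 0) →
      (∀ k < n, 0 < c k) →
      (∀ k < n, ∫ ω, d k ω ^ (2 * s + 2) ∂P ≤ D * c k ^ (2 * s + 2)) →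
      0 < V 0 → (∀ k < n, V k + c k ^ 2 ≤ V (k + 1)) →
      ∫ ω, (∑ j ∈ Finset.range n, d j ω) ^ (2 * s + 2) ∂P ≤ K * V n ^ (s + 1) := by
  obtain ⟨C, hC, hS⟩ := add_pow_even_le s
  refine ⟨2 * (C * D * ((2 * C) ^ s + 1)), by positivity, fun n d c V hd horth hc hdm hV0 hV => ?_⟩
  set K := 2 * (C * D * ((2 * C) ^ s + 1)) with hK
  have hKpos : 0 ≤ K := by positivity
  suffices ∀ m ≤ n, MemLp (fun ω => ∑ j ∈ Finset.range m, d j ω) (2 * s + 2 : ℕ) P ∧ 0 < V m ∧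
      ∫ ω, (∑ j ∈ Finset.range m, d j ω) ^ (2 * s + 2) ∂P ≤ K * V m ^ (s + 1) from
    (this n le_rfl).2.2
  intro m
  induction m with
  | zero =>
    intro _
    refine ⟨by simp, hV0, ?_⟩
    simp only [Finset.range_zero, Finset.sum_empty]
    rw [zero_pow (by omega), integral_zero]
    positivity
  | succ m ih =>
    intro hm
    obtain ⟨hSm, hVm, hI⟩ := ih (by omega)
    have hdk := hd m (by omega)
    have hck := hc m (by omega)
    have hVk := hV m (by omega)
    set S : Ω → ℝ := fun ω => ∑ j ∈ Finset.range m, d j ω with hSdef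
    have hsucc : ∀ ω, ∑ j ∈ Finset.range (m + 1), d j ω = S ω + d m ω := fun ω =>
      Finset.sum_range_succ _ _
    have hLp : MemLp (fun ω => S ω + d m ω) (2 * s + 2 : ℕ) P := hSm.add hdk
    simp only [hsucc]
    refine ⟨hLp, by nlinarith [sq_nonneg (c m)], ?_⟩
    -- This `t` makes the growth factor `1 + C * t` cost exactly `K / 2 * (c m ^ 2 * V m ^ s)`. The
    -- constant `K` is chosen so that the noise term costs at most another `K / 2 * (c m ^ 2 * W ^
    -- s)`, with `W = V (m + 1)`. Together they fit into the increase from `K * V m ^ (s + 1)` to `K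
    -- * W ^ (s + 1)`. Positivity of `V 0` and `c` makes `t` positive.
    set t : ℝ := c m ^ 2 / (2 * C * V m) with ht
    have htpos : 0 < t := by positivity
    have i1 : Integrable (fun ω => S ω ^ (2 * s + 2)) P := by
      simpa using hSm.integrable_pow_mul_pow (a := 2 * s + 2) (b := 0) rfl (by omega) hdk
    have i2 : Integrable (fun ω => S ω ^ (2 * s + 1) * d m ω) P := by
      simpa using hSm.integrable_pow_mul_pow (a := 2 * s + 1) (b := 1) rfl (by omega) hdk
    have i3 : Integrable (fun ω => d m ω ^ (2 * s + 2)) P := by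
      simpa using hdk.integrable_pow_mul_pow (a := 2 * s + 2) (b := 0) rfl (by omega) hdk
    have i0 : Integrable (fun ω => (S ω + d m ω) ^ (2 * s + 2)) P := by
      simpa using hLp.integrable_pow_mul_pow (a := 2 * s + 2) (b := 0) rfl (by omega) hdk
    have key : ∫ ω, (S ω + d m ω) ^ (2 * s + 2) ∂P ≤
        (1 + C * t) * ∫ ω, S ω ^ (2 * s + 2) ∂P +
          (2 * s + 2) * ∫ ω, S ω ^ (2 * s + 1) * d m ω ∂P +
          C * ((1 / t) ^ s + 1) * ∫ ω, d m ω ^ (2 * s + 2) ∂P := by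
      rw [← integral_const_mul, ← integral_const_mul, ← integral_const_mul,
        ← integral_add (i1.const_mul _) (i2.const_mul _), ← integral_add]
      rotate_left
      · exact (i1.const_mul _).add (i2.const_mul _)
      · exact i3.const_mul _
      refine integral_mono i0 (((i1.const_mul _).add (i2.const_mul _)).add (i3.const_mul _))
        fun ω => ?_
      have h1 := hS (S ω) (d m ω)
      have h2 := pow_mul_sq_le s htpos (S ω) (d m ω)
      simp only
      nlinarith [mul_le_mul_of_nonneg_left h2 hC.le]
    rw [horth m (by omega), mul_zero, add_zero] at key
    have hdm' := hdm m (by omega)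
    have h1 : (1 + C * t) * ∫ ω, S ω ^ (2 * s + 2) ∂P ≤
        K * V m ^ (s + 1) + K / 2 * (c m ^ 2 * V m ^ s) := by
      calc _ ≤ (1 + C * t) * (K * V m ^ (s + 1)) := by gcongr
        _ = _ := by rw [ht]; field_simp; ring
    have h2 : C * ((1 / t) ^ s + 1) * ∫ ω, d m ω ^ (2 * s + 2) ∂P ≤
        C * D * ((2 * C) ^ s * (c m ^ 2 * V m ^ s) + c m ^ (2 * s + 2)) := by
      calc _ ≤ C * ((1 / t) ^ s + 1) * (D * c m ^ (2 * s + 2)) := by gcongr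
        _ = _ := by
          have : (1 / t) ^ s * (c m ^ 2) ^ s = (2 * C) ^ s * V m ^ s := by
            rw [← mul_pow, ← mul_pow]; congr 1; rw [ht]; field_simp
          have e : c m ^ (2 * s + 2) = (c m ^ 2) ^ s * c m ^ 2 := by ring
          rw [e]
          linear_combination C * D * c m ^ 2 * this
    have h3 : V m ^ s ≤ V (m + 1) ^ s := by
      gcongr; nlinarith [sq_nonneg (c m)]
    have h4 : c m ^ (2 * s) ≤ V (m + 1) ^ s := by
      rw [pow_mul]; gcongr; linarith
    set W := V (m + 1)
    have h5 : K * V m ^ (s + 1) + K * (c m ^ 2 * W ^ s) ≤ K * W ^ (s + 1) := by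
      rw [← mul_add]
      gcongr
      calc V m ^ (s + 1) + c m ^ 2 * W ^ s = V m * V m ^ s + c m ^ 2 * W ^ s := by ring
        _ ≤ V m * W ^ s + c m ^ 2 * W ^ s := by gcongr
        _ = (V m + c m ^ 2) * W ^ s := by ring
        _ ≤ W * W ^ s := by
          have : 0 ≤ W ^ s := (pow_nonneg hVm.le s).trans h3
          gcongr
        _ = _ := by ring
    have h6 : C * D * ((2 * C) ^ s * (c m ^ 2 * V m ^ s) + c m ^ (2 * s + 2)) ≤
        K / 2 * (c m ^ 2 * W ^ s) := by
      have e : c m ^ (2 * s + 2) = c m ^ 2 * c m ^ (2 * s) := by ring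
      rw [e]
      calc _ ≤ C * D * ((2 * C) ^ s * (c m ^ 2 * W ^ s) + c m ^ 2 * W ^ s) := by gcongr
        _ = _ := by rw [hK]; ring
    have h7 : K / 2 * (c m ^ 2 * V m ^ s) ≤ K / 2 * (c m ^ 2 * W ^ s) := by gcongr
    linarith

end

/-! ### Growth of the products of `1 + f / w j` on generalized eigenspaces. -/

section

variable {K V : Type*} [Field K] [AddCommGroup V] [Module K V]

/-- The product of the maps `1 + f / w j` over `k ≤ j < n`. -/
def evolve (f : Module.End K V) (w : ℕ → K) (k : ℕ) : ℕ → Module.End K V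
  | 0 => 1
  | n + 1 => if k ≤ n then (1 + (w n)⁻¹ • f) * evolve f w k n else 1

theorem evolve_of_le (f : Module.End K V) (w : ℕ → K) {k n : ℕ} (h : n ≤ k) :
    evolve f w k n = 1 := by
  cases n with
  | zero => rfl
  | succ n => rw [evolve, if_neg (by omega)]

theorem evolve_succ (f : Module.End K V) (w : ℕ → K) {k n : ℕ} (h : k ≤ n) :
    evolve f w k (n + 1) = (1 + (w n)⁻¹ • f) * evolve f w k n := by
  rw [evolve, if_pos h]

theorem evolve_succ_apply (f : Module.End K V) (w : ℕ → K) {k n : ℕ} (h : k ≤ n) (v : V) :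
    evolve f w k (n + 1) v = evolve f w k n v + (w n)⁻¹ • f (evolve f w k n v) := by
  rw [evolve_succ f w h]; rfl

theorem commute_evolve (f : Module.End K V) (w : ℕ → K) (k n : ℕ) :
    Commute f (evolve f w k n) := by
  induction n with
  | zero => exact Commute.one_right f
  | succ n ih =>
    rw [evolve]
    split_ifs
    · exact ((Commute.one_right f).add_right ((Commute.refl f).smul_right _)).mul_right ih
    · exact Commute.one_right f

end

/-- The total logarithmic time elapsed between `k` and `n`. -/
noncomputable def elapsed (w : ℕ → ℝ) (k n : ℕ) : ℝ := ∑ j ∈ Finset.Ico k n, (w j)⁻¹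

theorem elapsed_nonneg {w : ℕ → ℝ} (hw : ∀ j, 0 < w j) (k n : ℕ) : 0 ≤ elapsed w k n :=
  Finset.sum_nonneg fun j _ => (inv_pos.2 (hw j)).le

theorem elapsed_succ (w : ℕ → ℝ) {k n : ℕ} (h : k ≤ n) :
    elapsed w k (n + 1) = elapsed w k n + (w n)⁻¹ := by
  rw [elapsed, Finset.sum_Ico_succ_top h, elapsed]

/-- Expand the squared modulus and use `1 + u ≤ exp u`. The quadratic error is harmless because the
squares of the `1 / w j` will be summable. -/
theorem norm_one_add_div_le (z : ℂ) {x : ℝ} (hx : 0 < x) :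
    ‖1 + (x : ℂ)⁻¹ * z‖ ≤ Real.exp (z.re * x⁻¹ + ‖z‖ ^ 2 * (x⁻¹) ^ 2) := by
  have h1 : ‖1 + (x : ℂ)⁻¹ * z‖ ^ 2 = 1 + 2 * (z.re * x⁻¹) + ‖z‖ ^ 2 * (x⁻¹) ^ 2 := by
    rw [← Complex.ofReal_inv, ← Complex.normSq_eq_norm_sq, ← Complex.normSq_eq_norm_sq,
      Complex.normSq_apply, Complex.normSq_apply]
    simp
    ring
  refine le_of_sq_le_sq ?_ (Real.exp_pos _).le
  rw [h1, ← Real.exp_nat_mul]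
  push_cast
  nlinarith [Real.add_one_le_exp (2 * (z.re * x⁻¹ + ‖z‖ ^ 2 * (x⁻¹) ^ 2)),
    (by positivity : 0 ≤ ‖z‖ ^ 2 * (x⁻¹) ^ 2)]

section

variable {V : Type*} [NormedAddCommGroup V] [NormedSpace ℂ V]

/-- The exponential rate dominating the scalar factors `1 + z / w j`. -/
noncomputable def growth (w : ℕ → ℝ) (z : ℂ) (ρ : ℝ) (k n : ℕ) : ℝ :=
  Real.exp (ρ * elapsed w k n + ‖z‖ ^ 2 * ∑ j ∈ Finset.Ico k n, ((w j)⁻¹) ^ 2)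

theorem growth_succ {w : ℕ → ℝ} (z : ℂ) (ρ : ℝ) {k n : ℕ} (h : k ≤ n) :
    growth w z ρ k (n + 1) =
      Real.exp (ρ * (w n)⁻¹ + ‖z‖ ^ 2 * ((w n)⁻¹) ^ 2) * growth w z ρ k n := by
  rw [growth, growth, ← Real.exp_add, elapsed_succ w h, Finset.sum_Ico_succ_top h]
  congr 1; ring

/-- Discrete variation of constants: the evolution of `v` is multiplied by `1 + z / w n` and forced
by `1 / w n` times the evolution of `f v - z • v`, which has lower nilpotency order. Relative to
`growth`, the forcing adds up to one more factor of elapsed time. -/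
theorem norm_evolve_le_of_sub {f : Module.End ℂ V} {w : ℕ → ℝ} (hw : ∀ j, 0 < w j) {z : ℂ}
    {ρ : ℝ} (hρ : 0 ≤ ρ) (hz : z.re ≤ ρ) {v : V} {C : ℝ} (hC : 0 ≤ C) (s : ℕ)
    (h : ∀ k n, ‖evolve f (fun j => (w j : ℂ)) k n (f v - z • v)‖ ≤
      C * (growth w z ρ k n * (1 + elapsed w k n) ^ s)) (k n : ℕ) :
    ‖evolve f (fun j => (w j : ℂ)) k n v‖ ≤
      growth w z ρ k n * (‖v‖ + C * (elapsed w k n * (1 + elapsed w k n) ^ s)) := by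
  have triv : ∀ k n, n ≤ k → ‖evolve f (fun j => (w j : ℂ)) k n v‖ ≤
      growth w z ρ k n * (‖v‖ + C * (elapsed w k n * (1 + elapsed w k n) ^ s)) := by
    intro k n hkn
    rw [evolve_of_le _ _ hkn, growth, elapsed, Finset.Ico_eq_empty_of_le hkn]
    simp
  induction n with
  | zero => exact triv k 0 (Nat.zero_le k)
  | succ n ih =>
    rcases Nat.lt_or_ge n k with hk | hk
    · exact triv k (n + 1) hk
    set F := evolve f (fun j => (w j : ℂ)) k n
    have hcomm : f (F v) = F (f v) :=
      congrArg (fun g : Module.End ℂ V => g v) (commute_evolve f (fun j => (w j : ℂ)) k n).eq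
    have e : evolve f (fun j => (w j : ℂ)) k (n + 1) v =
        (1 + (w n : ℂ)⁻¹ * z) • F v + (w n : ℂ)⁻¹ • F (f v - z • v) := by
      rw [evolve_succ_apply f _ hk, hcomm, map_sub, map_smul]
      module
    have hwn := hw n
    have hT := elapsed_nonneg hw k n
    set T := elapsed w k n
    set G := growth w z ρ k n with hG
    have hGp : 0 < G := Real.exp_pos _
    set E := Real.exp (ρ * (w n)⁻¹ + ‖z‖ ^ 2 * ((w n)⁻¹) ^ 2) with hE
    -- This is where a nonnegative rate `ρ` is needed: the forcing term may be multiplied by `E` as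
    -- well, so that `E * G` factors out.
    have hE1 : 1 ≤ E := Real.one_le_exp (by positivity)
    have hzE : ‖1 + (w n : ℂ)⁻¹ * z‖ ≤ E := by
      refine (norm_one_add_div_le z hwn).trans (Real.exp_le_exp.2 ?_)
      gcongr
    have hinv : ‖(w n : ℂ)⁻¹‖ = (w n)⁻¹ := by
      rw [norm_inv, Complex.norm_real, Real.norm_of_nonneg hwn.le]
    rw [e, growth_succ z ρ hk, elapsed_succ w hk]
    refine (norm_add_le _ _).trans ?_
    rw [norm_smul, norm_smul, hinv]
    have hx : 0 ≤ (w n)⁻¹ := (inv_pos.2 hwn).le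
    calc _ ≤ E * (G * (‖v‖ + C * (T * (1 + T) ^ s))) + (w n)⁻¹ * (C * (G * (1 + T) ^ s)) := by
          gcongr
          exact h k n
      _ ≤ E * (G * (‖v‖ + C * (T * (1 + T) ^ s))) + E * ((w n)⁻¹ * (C * (G * (1 + T) ^ s))) := by
          exact add_le_add le_rfl (le_mul_of_one_le_left (by positivity) hE1)
      _ = E * G * (‖v‖ + C * ((T + (w n)⁻¹) * (1 + T) ^ s)) := by ring
      _ ≤ _ := by
          gcongr
          linarith

/-- Growth of the evolution of a generalized eigenvector. -/
theorem exists_norm_evolve_le_growth {f : Module.End ℂ V} {w : ℕ → ℝ} (hw : ∀ j, 0 < w j) {z : ℂ}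
    {ρ : ℝ} (hρ : 0 ≤ ρ) (hz : z.re ≤ ρ) (s : ℕ) (v : V)
    (hv : ((f - z • (1 : Module.End ℂ V)) ^ (s + 1)) v = 0) :
    ∃ C, 0 ≤ C ∧ ∀ k n, ‖evolve f (fun j => (w j : ℂ)) k n v‖ ≤
      C * (growth w z ρ k n * (1 + elapsed w k n) ^ s) := by
  induction s generalizing v with
  | zero =>
    have h0 : f v - z • v = 0 := by simpa using hv
    refine ⟨‖v‖, norm_nonneg v, fun k n => ?_⟩
    have := norm_evolve_le_of_sub hw hρ hz (v := v) (f := f) le_rfl 0 (by simp [h0]) k n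
    simpa [mul_comm] using this
  | succ s ih =>
    obtain ⟨C, hC, h⟩ := ih (f v - z • v) (by
      rw [pow_succ, Module.End.mul_apply] at hv
      simpa using hv)
    refine ⟨‖v‖ + C, by positivity, fun k n => ?_⟩
    refine (norm_evolve_le_of_sub hw hρ hz hC s h k n).trans ?_
    have hT := elapsed_nonneg hw k n
    set T := elapsed w k n
    have hGp : 0 < growth w z ρ k n := Real.exp_pos _
    have h1 : 1 ≤ (1 + T) ^ (s + 1) := one_le_pow₀ (by linarith)
    have h2 : T * (1 + T) ^ s ≤ (1 + T) ^ (s + 1) := by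
      rw [pow_succ']; gcongr; linarith
    calc _ ≤ growth w z ρ k n * (‖v‖ * (1 + T) ^ (s + 1) + C * (1 + T) ^ (s + 1)) := by
          gcongr
          exact le_mul_of_one_le_right (norm_nonneg v) h1
      _ = _ := by ring

theorem exists_norm_evolve_le {f : Module.End ℂ V} {w : ℕ → ℝ} (hw : ∀ j, 0 < w j) {Q : ℝ}
    (hQ : ∀ k n, ∑ j ∈ Finset.Ico k n, ((w j)⁻¹) ^ 2 ≤ Q) {z : ℂ}
    {ρ : ℝ} (hρ : 0 ≤ ρ) (hz : z.re ≤ ρ) (s : ℕ) (v : V)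
    (hv : ((f - z • (1 : Module.End ℂ V)) ^ (s + 1)) v = 0) :
    ∃ C, 0 ≤ C ∧ ∀ k n, ‖evolve f (fun j => (w j : ℂ)) k n v‖ ≤
      C * (Real.exp (ρ * elapsed w k n) * (1 + elapsed w k n) ^ s) := by
  obtain ⟨C, hC, h⟩ := exists_norm_evolve_le_growth hw hρ hz s v hv
  refine ⟨C * Real.exp (‖z‖ ^ 2 * Q), by positivity, fun k n => (h k n).trans ?_⟩
  have hT := elapsed_nonneg hw k n
  rw [growth, Real.exp_add]
  calc _ ≤ C * ((Real.exp (ρ * elapsed w k n) * Real.exp (‖z‖ ^ 2 * Q)) *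
          (1 + elapsed w k n) ^ s) := by
        gcongr
        exact hQ k n
    _ = _ := by ring

theorem one_add_pow_le_exp (s : ℕ) {δ : ℝ} (hδ : 0 < δ) :
    ∃ C, 0 ≤ C ∧ ∀ t : ℝ, 0 ≤ t → (1 + t) ^ s ≤ C * Real.exp (δ * t) := by
  refine ⟨s.factorial / δ ^ s * Real.exp δ, by positivity, fun t ht => ?_⟩
  have h := Real.pow_div_factorial_le_exp (δ * (1 + t)) (by positivity) s
  rw [div_le_iff₀ (by positivity), mul_pow] at h
  rw [mul_assoc, ← Real.exp_add, show δ + δ * t = δ * (1 + t) by ring, div_mul_eq_mul_div,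
    le_div_iff₀ (by positivity)]
  linarith

/-- The polynomial factor from the Jordan block is absorbed into the gap between `ρ` and `max z.re
0`; the maximum keeps the rate nonnegative. -/
theorem exists_norm_evolve_le_of_lt {f : Module.End ℂ V} {w : ℕ → ℝ} (hw : ∀ j, 0 < w j) {Q : ℝ}
    (hQ : ∀ k n, ∑ j ∈ Finset.Ico k n, ((w j)⁻¹) ^ 2 ≤ Q) {z : ℂ}
    {ρ : ℝ} (hρ : 0 < ρ) (hz : z.re < ρ) (s : ℕ) (v : V)
    (hv : ((f - z • (1 : Module.End ℂ V)) ^ (s + 1)) v = 0) :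
    ∃ C, 0 ≤ C ∧ ∀ k n, ‖evolve f (fun j => (w j : ℂ)) k n v‖ ≤
      C * Real.exp (ρ * elapsed w k n) := by
  obtain ⟨C, hC, h⟩ := exists_norm_evolve_le hw hQ (le_max_right z.re 0) (le_max_left z.re 0) s v hv
  have hδ : 0 < ρ - max z.re 0 := sub_pos.2 (max_lt hz hρ)
  obtain ⟨C', hC', h'⟩ := one_add_pow_le_exp s hδ
  refine ⟨C * C', by positivity, fun k n => (h k n).trans ?_⟩
  have hT := elapsed_nonneg hw k n
  calc _ ≤ C * (Real.exp (max z.re 0 * elapsed w k n) *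
        (C' * Real.exp ((ρ - max z.re 0) * elapsed w k n))) := by
        gcongr
        exact h' _ hT
    _ = C * C' * (Real.exp (max z.re 0 * elapsed w k n) *
        Real.exp ((ρ - max z.re 0) * elapsed w k n)) := by ring
    _ = _ := by rw [← Real.exp_add]; congr 2; ring

end

/-! ### From generalized eigenspaces to the kernel of the leading left eigenvector. -/

section

variable {V : Type*} [NormedAddCommGroup V] [NormedSpace ℂ V]

/-- The vectors whose evolution is `O(B)`. -/
def boundedEvolution (f : Module.End ℂ V) (w : ℕ → ℝ) (B : ℕ → ℕ → ℝ) :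
    Submodule ℂ V where
  carrier := {v | ∃ C, 0 ≤ C ∧ ∀ k n, ‖evolve f (fun j => (w j : ℂ)) k n v‖ ≤ C * B k n}
  zero_mem' := ⟨0, le_rfl, by simp⟩
  add_mem' := by
    rintro x y ⟨C, hC, h⟩ ⟨C', hC', h'⟩
    refine ⟨C + C', by positivity, fun k n => ?_⟩
    rw [map_add, add_mul]
    exact (norm_add_le _ _).trans (add_le_add (h k n) (h' k n))
  smul_mem' := by
    rintro c x ⟨C, hC, h⟩
    refine ⟨‖c‖ * C, by positivity, fun k n => ?_⟩
    rw [map_smul, norm_smul, mul_assoc]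
    gcongr
    exact h k n

/-- Composing `φ` with `(f - z) ^ m` multiplies it by `(b - z) ^ m`, which is nonzero. -/
theorem dual_eq_zero_of_mem_maxGenEigenspace {f : Module.End ℂ V} {b z : ℂ} {φ : V →ₗ[ℂ] ℂ}
    (hφ : ∀ v, φ (f v) = b * φ v) (hz : z ≠ b) {v : V} (hv : v ∈ f.maxGenEigenspace z) :
    φ v = 0 := by
  obtain ⟨m, hm⟩ := (Module.End.mem_maxGenEigenspace f z v).1 hv
  have key : ∀ (m : ℕ) (v : V), φ (((f - z • (1 : Module.End ℂ V)) ^ m) v) = (b - z) ^ m * φ v := by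
    intro m
    induction m with
    | zero => simp
    | succ m ih =>
      intro v
      rw [pow_succ, Module.End.mul_apply, ih]
      simp [hφ]
      ring
  have := key m v
  rw [hm, map_zero] at this
  exact (mul_eq_zero.1 this.symm).resolve_left (pow_ne_zero _ (sub_ne_zero.2 hz.symm))

/-- If the leading eigenvalue `b` is simple, with left eigenvector `φ`, then bounds for the
evolution on the other generalized eigenspaces extend to the kernel of `φ`. -/
theorem exists_norm_evolve_le_of_dual_eq_zero [FiniteDimensional ℂ V] {f : Module.End ℂ V} {b : ℂ}
    {φ : V →ₗ[ℂ] ℂ} (hφ0 : φ ≠ 0) (hφ : ∀ v, φ (f v) = b * φ v)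
    (hb : Module.finrank ℂ (f.maxGenEigenspace b) ≤ 1) {w : ℕ → ℝ} {B : ℕ → ℕ → ℝ}
    (h : ∀ z, z ≠ b → ∀ v ∈ f.maxGenEigenspace z, ∃ C, 0 ≤ C ∧ ∀ k n,
      ‖evolve f (fun j => (w j : ℂ)) k n v‖ ≤ C * B k n) {v : V} (hv : φ v = 0) :
    ∃ C, 0 ≤ C ∧ ∀ k n, ‖evolve f (fun j => (w j : ℂ)) k n v‖ ≤ C * B k n := by
  set W := boundedEvolution f w B
  have htop : (W ⊓ LinearMap.ker φ) ⊔ f.maxGenEigenspace b = ⊤ := by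
    rw [eq_top_iff, ← Module.End.iSup_maxGenEigenspace_eq_top f]
    refine iSup_le fun z => ?_
    by_cases hz : z = b
    · rw [hz]; exact le_sup_right
    · exact le_sup_of_le_left fun x hx => ⟨h z hz x hx, dual_eq_zero_of_mem_maxGenEigenspace hφ hz hx⟩
  obtain ⟨x, hx, y, hy, rfl⟩ := Submodule.mem_sup.1 (htop ▸ Submodule.mem_top : v ∈ _)
  have hφx : φ x = 0 := hx.2
  have hφy : φ y = 0 := by simpa [hφx] using hv
  suffices y = 0 by
    rw [this, add_zero]; exact hx.1
  obtain ⟨e, he⟩ := finrank_le_one_iff.1 hb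
  obtain ⟨c, hc⟩ := he ⟨y, hy⟩
  have hc' : c • (e : V) = y := congrArg Subtype.val hc
  -- If `φ` vanished on the line for `b`, it would vanish on both summands of the whole space. Hence
  -- `φ` is injective on that line, and the component of `v` there is zero.
  have hφe : φ e ≠ 0 := by
    intro h0
    apply hφ0
    ext u
    obtain ⟨x', hx', y', hy', rfl⟩ := Submodule.mem_sup.1 (htop ▸ Submodule.mem_top : u ∈ _)
    obtain ⟨c', hc'⟩ := he ⟨y', hy'⟩
    have hc'' : c' • (e : V) = y' := congrArg Subtype.val hc'
    have : φ x' = 0 := hx'.2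
    simp [this, ← hc'', h0]
  rw [← hc', map_smul, smul_eq_mul, mul_eq_zero] at hφy
  rw [← hc', hφy.resolve_right hφe, zero_smul]

end

section

variable {q : ℕ}

theorem evolve_toLin'_map (A : Matrix (Fin q) (Fin q) ℝ) (w : ℕ → ℝ) (k n : ℕ) (y : Fin q → ℝ) :
    evolve (Matrix.toLin' (A.map Complex.ofReal)) (fun j => (w j : ℂ)) k n (fun i => (y i : ℂ)) =
      fun i => ((evolve (Matrix.toLin' A) w k n y i : ℝ) : ℂ) := by
  induction n with
  | zero => rfl
  | succ n ih =>
    rcases Nat.lt_or_ge n k with hk | hk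
    · rw [evolve_of_le _ _ hk, evolve_of_le _ _ hk]; rfl
    · rw [evolve_succ_apply _ _ hk, evolve_succ_apply _ _ hk, ih]
      ext i
      simp [Matrix.toLin'_apply, Matrix.mulVec, dotProduct]

/-- Bounds for the real evolution on the hyperplane `∑ a j * y j = 0`. -/
theorem exists_abs_evolve_le (A : Matrix (Fin q) (Fin q) ℝ) {a : Fin q → ℝ} (ha : a ≠ 0) {b : ℝ}
    (hA : ∀ j, ∑ i, a i * A i j = b * a j)
    (hb : Module.finrank ℂ
      (Module.End.maxGenEigenspace (Matrix.toLin' (A.map Complex.ofReal)) (b : ℂ)) ≤ 1) {w : ℕ → ℝ}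
    {B : ℕ → ℕ → ℝ} (hB : ∀ k n, 0 ≤ B k n)
    (h : ∀ z : ℂ, z ≠ b → ∀ v ∈ Module.End.maxGenEigenspace (Matrix.toLin' (A.map Complex.ofReal)) z,
      ∃ C, 0 ≤ C ∧ ∀ k n, ‖evolve (Matrix.toLin' (A.map Complex.ofReal)) (fun j => (w j : ℂ)) k n v‖
        ≤ C * B k n) :
    ∃ C, 0 ≤ C ∧ ∀ y : Fin q → ℝ, ∑ j, a j * y j = 0 → ∀ k n i,
      |evolve (Matrix.toLin' A) w k n y i| ≤ C * B k n * ∑ j, |y j| := by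
  set f := Matrix.toLin' (A.map Complex.ofReal) with hf
  let φ : (Fin q → ℂ) →ₗ[ℂ] ℂ := ∑ j, (a j : ℂ) • LinearMap.proj j
  have φ_apply : ∀ v, φ v = ∑ j, (a j : ℂ) * v j := fun v => by simp [φ]
  obtain ⟨j₀, hj₀⟩ := Function.ne_iff.1 ha
  have hφ0 : φ ≠ 0 := by
    intro h0
    have := congrArg (fun g : (Fin q → ℂ) →ₗ[ℂ] ℂ => g (Pi.single j₀ 1)) h0
    simp only [φ_apply, LinearMap.zero_apply] at this
    simp [Pi.single_apply] at this
    exact hj₀ this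
  have hφ : ∀ v, φ (f v) = b * φ v := by
    intro v
    rw [φ_apply, φ_apply, Finset.mul_sum]
    simp only [hf, Matrix.toLin'_apply, Matrix.mulVec, dotProduct, Finset.mul_sum]
    rw [Finset.sum_comm]
    refine Finset.sum_congr rfl fun j _ => ?_
    have := congrArg Complex.ofReal (hA j)
    push_cast at this
    rw [← mul_assoc, ← this, Finset.sum_mul]
    refine Finset.sum_congr rfl fun i _ => ?_
    simp [mul_assoc]
  -- Projections of the basis vectors to the hyperplane along coordinate `j₀`. Every `y` in the
  -- hyperplane is the sum of the `y j • u j`, so bounds for these finitely many vectors give one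
  -- constant for all `y`.
  let u : Fin q → Fin q → ℝ := fun j => Pi.single j 1 - (a j / a j₀) • Pi.single j₀ 1
  have hu : ∀ j, ∑ i, a i * u j i = 0 := by
    intro j
    have hj : a j₀ ≠ 0 := hj₀
    simp [u, mul_sub, Finset.sum_sub_distrib, Pi.single_apply]
    field_simp
    simp
  have key : ∀ j, ∃ C, 0 ≤ C ∧ ∀ k n i, |evolve (Matrix.toLin' A) w k n (u j) i| ≤ C * B k n := by
    intro j
    obtain ⟨C, hC, hC'⟩ := exists_norm_evolve_le_of_dual_eq_zero hφ0 hφ hb h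
      (v := fun i => (u j i : ℂ)) (by rw [φ_apply]; exact_mod_cast hu j)
    refine ⟨C, hC, fun k n i => ?_⟩
    have h1 := (norm_le_pi_norm _ i).trans (hC' k n)
    rw [evolve_toLin'_map] at h1
    simpa using h1
  choose C hC hC' using key
  refine ⟨∑ j, C j, Finset.sum_nonneg fun j _ => hC j, fun y hy k n i => ?_⟩
  have hy' : y = ∑ j, y j • u j := by
    have e1 : ∑ j, y j * (a j / a j₀) = 0 := by
      have : ∑ j, y j * (a j / a j₀) = (∑ j, a j * y j) / a j₀ := by
        rw [Finset.sum_div]; exact Finset.sum_congr rfl fun j _ => by ring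
      rw [this, hy, zero_div]
    ext i
    simp only [u, Finset.sum_apply, Pi.smul_apply, Pi.sub_apply, smul_eq_mul, mul_sub,
      Finset.sum_sub_distrib]
    have e2 : ∑ j, y j * (a j / a j₀ * (Pi.single j₀ 1 : Fin q → ℝ) i) = 0 := by
      simp only [← mul_assoc]
      rw [← Finset.sum_mul, e1, zero_mul]
    rw [e2]
    simp [Pi.single_apply]
  conv_lhs => rw [hy']
  rw [map_sum, Finset.sum_apply]
  simp only [map_smul, Pi.smul_apply, smul_eq_mul]
  refine (Finset.abs_sum_le_sum_abs _ _).trans ?_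
  rw [Finset.mul_sum]
  refine Finset.sum_le_sum fun j _ => ?_
  rw [abs_mul, mul_comm]
  gcongr
  refine (hC' j k n i).trans ?_
  gcongr
  · exact hB k n
  · exact Finset.single_le_sum (fun j _ => hC j) (Finset.mem_univ j)

/-- At `jordanIndex M z`, the nilpotent part of `M` vanishes on the generalized eigenspace. -/
theorem jordanIndex_spec (M : Matrix (Fin q) (Fin q) ℂ) (z : ℂ) {v : Fin q → ℂ}
    (hv : v ∈ Module.End.maxGenEigenspace (Matrix.toLin' M) z) :
    ((Matrix.toLin' M - z • (1 : Module.End ℂ (Fin q → ℂ))) ^ (jordanIndex M z + 1)) v = 0 := by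
  have hne : {k : ℕ | ∀ v ∈ Module.End.maxGenEigenspace (Matrix.toLin' M) z,
    ((Matrix.toLin' M - z • (1 : Module.End ℂ (Fin q → ℂ))) ^ (k + 1)) v = 0}.Nonempty := by
    -- Nonemptiness matters: the infimum of an empty set of naturals would be the meaningless value
    -- `0`.
    refine ⟨q, fun v hv => ?_⟩
    rw [Module.End.maxGenEigenspace_eq_genEigenspace_finrank, Module.End.mem_genEigenspace_nat,
      LinearMap.mem_ker, Module.finrank_fin_fun] at hv
    rw [pow_succ', Module.End.mul_apply, hv, map_zero]
  exact Nat.sInf_mem hne v hv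

end

/-! ### Eigenvalue lists and generalized eigenspaces. -/

section

variable {q : ℕ} {M : Matrix (Fin q) (Fin q) ℂ} {ev : Fin q → ℂ}

theorem IsEigenvalueList.exists_eq (hev : IsEigenvalueList M ev) {z : ℂ} {v : Fin q → ℂ}
    (hv : v ∈ Module.End.maxGenEigenspace (Matrix.toLin' M) z) (hv0 : v ≠ 0) : ∃ j, ev j = z := by
  have h1 : 0 < Module.finrank ℂ (Module.End.maxGenEigenspace (Matrix.toLin' M) z) :=
    Module.finrank_pos_iff_exists_ne_zero.2 ⟨⟨v, hv⟩, fun h => hv0 (congrArg Subtype.val h)⟩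
  rw [LinearMap.finrank_maxGenEigenspace_eq, Matrix.charpoly_toLin', ← Polynomial.count_roots,
    Multiset.count_pos, hev.roots_eq] at h1
  simpa using h1

/-- The dimension of a generalized eigenspace is the multiplicity of the root, that is, the number
of list entries equal to `z`. -/
theorem IsEigenvalueList.finrank_maxGenEigenspace_le_one (hev : IsEigenvalueList M ev) {z : ℂ}
    (i : Fin q) (h : ∀ j, j ≠ i → ev j ≠ z) :
    Module.finrank ℂ (Module.End.maxGenEigenspace (Matrix.toLin' M) z) ≤ 1 := by
  rw [LinearMap.finrank_maxGenEigenspace_eq, Matrix.charpoly_toLin', ← Polynomial.count_roots,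
    hev.roots_eq, Multiset.count_map]
  have : Multiset.filter (fun a => z = ev a) (Finset.univ : Finset (Fin q)).val ≤ {i} := by
    rw [← Finset.filter_val, ← Finset.singleton_val, Finset.val_le_iff]
    intro j hj
    rw [Finset.mem_filter] at hj
    by_contra hne
    exact h j (by simpa using hne) hj.2.symm
  simpa using Multiset.card_le_card this

end

/-! ### Sums along the arithmetic progression `w`. -/

section

variable {w : ℕ → ℝ} {b : ℝ}

theorem elapsed_mono {k k' n : ℕ} (hw : ∀ j, 0 < w j) (h : k ≤ k') :
    elapsed w k' n ≤ elapsed w k n :=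
  Finset.sum_le_sum_of_subset_of_nonneg (Finset.Ico_subset_Ico_left h)
    fun j _ _ => (inv_pos.2 (hw j)).le

/-- From `log x ≤ x - 1` at `x = w j / w (j + 1)` one gets `b / w (j + 1) ≤ log (w (j + 1) / w j)`,
which telescopes. Starting at `k + 1`, where noise `k` begins to evolve, makes the comparison hold
without a constant. -/
theorem mul_elapsed_le (hw : ∀ j, 0 < w j) (hstep : ∀ j, w (j + 1) = w j + b) (hb : 0 < b)
    {k n : ℕ} (h : k < n) : b * elapsed w (k + 1) n ≤ Real.log (w n / w k) := by
  have key : ∀ n, k ≤ n → b * elapsed w (k + 1) (n + 1) ≤ Real.log (w n / w k) := by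
    intro n hn
    induction n, hn using Nat.le_induction with
    | base => simp [elapsed]
    | succ n hn ih =>
      have h0 := hw k
      have h1 := hw n
      have h2 := hw (n + 1)
      rw [elapsed_succ w (by omega)]
      have h3 := Real.log_le_sub_one_of_pos (div_pos h1 h2)
      rw [Real.log_div h1.ne' h2.ne'] at h3
      rw [Real.log_div h1.ne' h0.ne'] at ih
      rw [Real.log_div h2.ne' h0.ne']
      have h4 : w n / w (n + 1) - 1 = -(b * (w (n + 1))⁻¹) := by
        field_simp; rw [hstep]; ring
      rw [h4] at h3
      linarith
  obtain ⟨m, rfl⟩ : ∃ m, n = m + 1 := ⟨n - 1, by omega⟩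
  refine (key m (by omega)).trans (Real.log_le_log (div_pos (hw m) (hw k)) ?_)
  have := (hw k).le
  gcongr
  rw [hstep]; linarith

/-- Comparison with the telescoping sum of `1 / w j - 1 / w (j + 1)`; the ratio `w (j + 1) / w j` is
at most `1 + b / w 0`. -/
theorem exists_sum_inv_sq_le (hw : ∀ j, 0 < w j) (hstep : ∀ j, w (j + 1) = w j + b) (hb : 0 < b) :
    ∃ Q : ℝ, ∀ k n, ∑ j ∈ Finset.Ico k n, ((w j)⁻¹) ^ 2 ≤ Q := by
  have hmono : ∀ j, w 0 ≤ w j := fun j => by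
    induction j with
    | zero => exact le_rfl
    | succ j ih => rw [hstep]; linarith
  set c := (1 + b / w 0) / b
  have h0 := hw 0
  have key : ∀ n, ∑ j ∈ Finset.range n, ((w j)⁻¹) ^ 2 ≤ c * ((w 0)⁻¹ - (w n)⁻¹) := by
    intro n
    induction n with
    | zero => simp
    | succ n ih =>
      rw [Finset.sum_range_succ]
      suffices ((w n)⁻¹) ^ 2 ≤ c * ((w n)⁻¹ - (w (n + 1))⁻¹) by linarith
      have h1 := hw n
      have h2 := hw (n + 1)
      have e : c * ((w n)⁻¹ - (w (n + 1))⁻¹) = (1 + b / w 0) * ((w n)⁻¹ * (w (n + 1))⁻¹) := by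
        simp only [c]; field_simp; rw [hstep]; ring
      have h3 : w (n + 1) ≤ (1 + b / w 0) * w n := by
        have : b ≤ b / w 0 * w n := by
          rw [div_mul_eq_mul_div, le_div_iff₀ h0]; gcongr; exact hmono n
        rw [hstep]; linarith
      have h4 : (w n)⁻¹ ≤ (1 + b / w 0) * (w (n + 1))⁻¹ := by
        rw [← div_eq_mul_inv, le_div_iff₀ h2, inv_mul_le_iff₀ h1]; linarith
      rw [e, sq]
      calc (w n)⁻¹ * (w n)⁻¹ ≤ (w n)⁻¹ * ((1 + b / w 0) * (w (n + 1))⁻¹) := by gcongr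
        _ = _ := by ring
  refine ⟨c * (w 0)⁻¹, fun k n => ?_⟩
  have hc : 0 ≤ c := by positivity
  calc _ ≤ ∑ j ∈ Finset.range n, ((w j)⁻¹) ^ 2 :=
        Finset.sum_le_sum_of_subset_of_nonneg (fun j hj => by simp at hj ⊢; exact hj.2)
          fun j _ _ => sq_nonneg _
    _ ≤ c * ((w 0)⁻¹ - (w n)⁻¹) := key n
    _ ≤ _ := by gcongr; linarith [inv_pos.2 (hw n)]

theorem exists_sum_rpow_le (hw : ∀ j, 0 < w j) (hstep : ∀ j, w (j + 1) = w j + b) (hb : 0 < b)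
    {β : ℝ} (hβ0 : 0 ≤ β) (hβ : β < 1) :
    ∃ K : ℝ, 0 ≤ K ∧ ∀ n, ∑ k ∈ Finset.range n, (w n / w k) ^ β ≤ K * w n := by
  have hmono : ∀ j, w 0 ≤ w j := fun j => by
    induction j with
    | zero => exact le_rfl
    | succ j ih => rw [hstep]; linarith
  have h0 := hw 0
  have h1β : 0 < 1 - β := by linarith
  -- One step of the induction multiplies the sum plus one by `(1 + b / w n) ^ β ≤ 1 + β * b / w n`.
  -- It closes when `K * b * (1 - β)` covers the excess `1 + b / w 0`, hence the need for `β < 1`.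
  set K := (1 + b / w 0) / (b * (1 - β)) with hK
  have hKp : 0 ≤ K := by positivity
  have hKe : K * b * (1 - β) = 1 + b / w 0 := by rw [hK]; field_simp
  refine ⟨K, hKp, fun n => ?_⟩
  induction n with
  | zero => simpa using mul_nonneg hKp h0.le
  | succ n ih =>
    have h1 := hw n
    have h2 := hw (n + 1)
    have e : ∑ k ∈ Finset.range (n + 1), (w (n + 1) / w k) ^ β =
        (w (n + 1) / w n) ^ β * (∑ k ∈ Finset.range n, (w n / w k) ^ β + 1) := by
      rw [Finset.sum_range_succ, mul_add, mul_one, Finset.mul_sum]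
      congr 1
      refine Finset.sum_congr rfl fun k _ => ?_
      rw [← Real.mul_rpow (by positivity) (div_nonneg h1.le (hw k).le)]
      congr 1
      field_simp
    have h3 : (w (n + 1) / w n) ^ β ≤ 1 + β * (b / w n) := by
      have : w (n + 1) / w n = 1 + b / w n := by rw [hstep]; field_simp
      rw [this]
      exact rpow_one_add_le_one_add_mul_self (by linarith [div_pos hb h1]) hβ0 hβ.le
    have h4 : b / w n ≤ b / w 0 := by gcongr; exact hmono n
    rw [e]
    calc _ ≤ (1 + β * (b / w n)) * (K * w n + 1) := by
          have : 0 ≤ ∑ k ∈ Finset.range n, (w n / w k) ^ β :=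
            Finset.sum_nonneg fun k _ => Real.rpow_nonneg (div_nonneg h1.le (hw k).le) β
          gcongr
      _ = K * w n + K * b * β + 1 + β * (b / w n) := by field_simp; ring
      _ ≤ K * w n + K * b * β + 1 + b / w 0 := by
          have : 0 ≤ b / w n := by positivity
          nlinarith
      _ = K * w (n + 1) := by rw [hstep]; linear_combination -hKe

theorem exp_two_mul_elapsed_le (hw : ∀ j, 0 < w j) (hstep : ∀ j, w (j + 1) = w j + b)
    (hb : 0 < b) {ρ : ℝ} (hρ : 0 ≤ ρ) {k n : ℕ} (h : k < n) :
    Real.exp (ρ * elapsed w (k + 1) n) ^ 2 ≤ (w n / w k) ^ (2 * ρ / b) := by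
  rw [← Real.exp_nat_mul, Real.rpow_def_of_pos (div_pos (hw n) (hw k))]
  refine Real.exp_le_exp.2 ?_
  have := mul_elapsed_le hw hstep hb h
  calc _ = (b * elapsed w (k + 1) n) * (2 * ρ / b) := by field_simp; push_cast; ring
    _ ≤ _ := by gcongr

theorem eq_add_nat_mul (hstep : ∀ j, w (j + 1) = w j + b) (n : ℕ) : w n = w 0 + n * b := by
  induction n with
  | zero => simp
  | succ n ih => rw [hstep, ih]; push_cast; ring

theorem le_mul_nat (hw : ∀ j, 0 < w j) (hstep : ∀ j, w (j + 1) = w j + b) {n : ℕ} (hn : 1 ≤ n) :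
    w n ≤ (w 0 + b) * n := by
  rw [eq_add_nat_mul hstep n]
  have : (1 : ℝ) ≤ n := by exact_mod_cast hn
  nlinarith [hw 0]

/-- Total variance in the subcritical case. -/
theorem exists_variance_sum_le_of_lt (hw : ∀ j, 0 < w j) (hstep : ∀ j, w (j + 1) = w j + b)
    (hb : 0 < b) {ρ : ℝ} (hρ0 : 0 ≤ ρ) (hρ : ρ < b / 2) (C : ℝ) :
    ∃ K : ℝ, 0 ≤ K ∧ ∀ n : ℕ, 1 ≤ n →
      w n + ∑ k ∈ Finset.range n, (C * Real.exp (ρ * elapsed w (k + 1) n)) ^ 2 ≤ K * n := by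
  obtain ⟨K, hK, h⟩ := exists_sum_rpow_le hw hstep hb (β := 2 * ρ / b) (by positivity)
    (by rw [div_lt_one hb]; linarith)
  have h0 := hw 0
  refine ⟨(1 + C ^ 2 * K) * (w 0 + b), by positivity, fun n hn => ?_⟩
  calc _ ≤ w n + ∑ k ∈ Finset.range n, C ^ 2 * (w n / w k) ^ (2 * ρ / b) := by
        gcongr with k hk
        rw [mul_pow]
        gcongr
        exact exp_two_mul_elapsed_le hw hstep hb hρ0 (Finset.mem_range.1 hk)
    _ ≤ w n + C ^ 2 * (K * w n) := by
        rw [← Finset.mul_sum]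
        gcongr
        exact h n
    _ = (1 + C ^ 2 * K) * w n := by ring
    _ ≤ (1 + C ^ 2 * K) * ((w 0 + b) * n) := by
        gcongr
        exact le_mul_nat hw hstep hn
    _ = _ := by ring

theorem exists_one_add_elapsed_le (hw : ∀ j, 0 < w j) (hstep : ∀ j, w (j + 1) = w j + b)
    (hb : 0 < b) : ∃ K : ℝ, 0 ≤ K ∧ ∀ n : ℕ, 2 ≤ n → 1 + elapsed w 0 n ≤ K * Real.log n := by
  have h0 := hw 0
  set D := 1 + (w 0)⁻¹ + |Real.log ((w 0 + b) / w 0)| / b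
  refine ⟨D / Real.log 2 + 1 / b, by positivity, fun n hn => ?_⟩
  have hn' : (2 : ℝ) ≤ n := by exact_mod_cast hn
  have hlog2 : 0 < Real.log 2 := Real.log_pos (by norm_num)
  have hlog : Real.log 2 ≤ Real.log n := Real.log_le_log (by norm_num) hn'
  -- The logarithmic bound starts at index one, so the first term is split off. All constants are
  -- then absorbed using `log n ≥ log 2`.
  have e : elapsed w 0 n = (w 0)⁻¹ + elapsed w (0 + 1) n := by
    rw [elapsed, elapsed, Finset.sum_eq_sum_Ico_succ_bot (by omega)]
  have h1 : elapsed w (0 + 1) n ≤ Real.log (w n / w 0) / b := by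
    rw [le_div_iff₀ hb, mul_comm]
    exact mul_elapsed_le hw hstep hb (by omega)
  have h2 : Real.log (w n / w 0) ≤ |Real.log ((w 0 + b) / w 0)| + Real.log n := by
    calc Real.log (w n / w 0) ≤ Real.log ((w 0 + b) / w 0 * n) := by
          refine Real.log_le_log (div_pos (hw n) h0) ?_
          rw [div_mul_eq_mul_div]
          gcongr
          exact le_mul_nat hw hstep (by omega)
      _ = Real.log ((w 0 + b) / w 0) + Real.log n :=
          Real.log_mul (by positivity) (by positivity)
      _ ≤ _ := by gcongr; exact le_abs_self _
  have h3 : Real.log (w n / w 0) / b ≤ |Real.log ((w 0 + b) / w 0)| / b + 1 / b * Real.log n := by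
    rw [one_div_mul_eq_div, ← add_div]; gcongr
  have h4 : D ≤ D / Real.log 2 * Real.log n := by
    have hD : 0 ≤ D := by positivity
    rw [div_mul_eq_mul_div, le_div_iff₀ hlog2]
    gcongr
  rw [add_mul]
  simp only [D] at h4 ⊢
  linarith

/-- Total variance in the critical case. -/
theorem exists_variance_sum_le_of_eq (hw : ∀ j, 0 < w j) (hstep : ∀ j, w (j + 1) = w j + b)
    (hb : 0 < b) (ν : ℕ) (C : ℝ) :
    ∃ K : ℝ, 0 ≤ K ∧ ∀ n : ℕ, 2 ≤ n →
      w n + ∑ k ∈ Finset.range n, (C * (Real.exp (b / 2 * elapsed w (k + 1) n) *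
        (1 + elapsed w (k + 1) n) ^ ν)) ^ 2 ≤ K * (n * Real.log n ^ (2 * ν + 1)) := by
  obtain ⟨L, hL, h⟩ := exists_one_add_elapsed_le hw hstep hb
  have h0 := hw 0
  refine ⟨(1 + C ^ 2) * ((w 0 + b) * L ^ (2 * ν + 1)), by positivity, fun n hn => ?_⟩
  have hT := elapsed_nonneg hw 0 n
  set T := elapsed w 0 n with hTdef
  have hwn := hw n
  -- At the critical rate the squared exponential is at most `w n / w k`. The remaining sum of `1 /
  -- w k` is `T` itself, which raises the power of the logarithm from `2 * ν` to `2 * ν + 1`.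
  have hterm : ∀ k ∈ Finset.range n, (C * (Real.exp (b / 2 * elapsed w (k + 1) n) *
        (1 + elapsed w (k + 1) n) ^ ν)) ^ 2 ≤ C ^ 2 * (w n * (1 + T) ^ (2 * ν)) * (w k)⁻¹ := by
    intro k hk
    have h1 := exp_two_mul_elapsed_le hw hstep hb (half_pos hb).le (Finset.mem_range.1 hk)
    rw [show 2 * (b / 2) / b = 1 by field_simp, Real.rpow_one] at h1
    have h2 := elapsed_nonneg hw (k + 1) n
    have h3 : elapsed w (k + 1) n ≤ T := elapsed_mono hw (Nat.zero_le _)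
    have h4 := div_nonneg hwn.le (hw k).le
    calc _ = C ^ 2 * (Real.exp (b / 2 * elapsed w (k + 1) n) ^ 2 *
          (1 + elapsed w (k + 1) n) ^ (2 * ν)) := by ring
      _ ≤ C ^ 2 * (w n / w k * (1 + T) ^ (2 * ν)) := by gcongr
      _ = _ := by ring
  have hsum : ∑ k ∈ Finset.range n, (w k)⁻¹ = T := by rw [hTdef, elapsed, Finset.range_eq_Ico]
  calc _ ≤ w n + C ^ 2 * (w n * (1 + T) ^ (2 * ν)) * T := by
        rw [← hsum, Finset.mul_sum, hsum]
        gcongr with k hk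
        exact hterm k hk
    _ ≤ w n * (1 + T) ^ (2 * ν + 1) + C ^ 2 * (w n * (1 + T) ^ (2 * ν)) * (1 + T) := by
        gcongr
        · exact le_mul_of_one_le_right hwn.le (one_le_pow₀ (by linarith))
        · linarith
    _ = (1 + C ^ 2) * (w n * (1 + T) ^ (2 * ν + 1)) := by ring
    _ ≤ (1 + C ^ 2) * (((w 0 + b) * n) * (L * Real.log n) ^ (2 * ν + 1)) := by
        gcongr
        · exact le_mul_nat hw hstep (by omega)
        · exact h n hn
    _ = _ := by ring

end

/-! ### One step of the urn: laws and expectations given the past. -/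

section

variable {Ω : Type*} {q : ℕ}

theorem sum_indicator_fiber (I : Ω → Fin q) (f : Ω → ℝ) :
    f = fun ω => ∑ i, ({ω | I ω = i}.indicator f) ω := by
  ext ω
  simp [Set.indicator_apply]

variable [MeasurableSpace Ω] {P : Measure Ω} {I : Ω → Fin q}

theorem memLp_of_forall_restrict_fiber (hI : Measurable I) {f : Ω → ℝ} {p : ENNReal}
    (h : ∀ i, MemLp f p (P.restrict {ω | I ω = i})) : MemLp f p P := by
  rw [sum_indicator_fiber I f]
  refine memLp_finsetSum _ fun i _ => ?_
  exact (memLp_indicator_iff_restrict (hI (measurableSet_singleton i))).2 (h i)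

theorem integral_eq_sum_fiber (hI : Measurable I) {f : Ω → ℝ} (hf : Integrable f P) :
    ∫ ω, f ω ∂P = ∑ i, ∫ ω in {ω | I ω = i}, f ω ∂P := by
  have hm : ∀ i, MeasurableSet {ω | I ω = i} := fun i => hI (measurableSet_singleton i)
  conv_lhs => rw [sum_indicator_fiber I f]
  rw [integral_finsetSum _ fun i _ => hf.indicator (hm i)]
  exact Finset.sum_congr rfl fun i _ => integral_indicator (hm i)

end

theorem urnPast_mono {q : ℕ} {Ω : Type*} (X : ℕ → Ω → EuclideanSpace ℝ (Fin q))
    (I : ℕ → Ω → Fin q) : Monotone (urnPast X I) := by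
  intro m n h
  refine sup_le_sup ?_ ?_
  · exact biSup_mono fun k hk => hk.trans h
  · exact biSup_mono fun k hk => hk.trans_le h

theorem measurable_state_urnPast {q : ℕ} {Ω : Type*} (X : ℕ → Ω → EuclideanSpace ℝ (Fin q))
    (I : ℕ → Ω → Fin q) {k n : ℕ} (h : k ≤ n) : Measurable[urnPast X I n] (X k) := by
  refine Measurable.mono (comap_measurable (X k)) (le_sup_of_le_left ?_) le_rfl
  exact le_biSup (fun k => MeasurableSpace.comap (X k) inferInstance) h

namespace PolyaUrn

variable {q : ℕ} {U : PolyaUrn q}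

/-- The total activity of a state. -/
noncomputable def weight (U : PolyaUrn q) (x : EuclideanSpace ℝ (Fin q)) : ℝ :=
  ∑ j, U.activity j * x j

/-- The conditional mean of the next increment in a given state. -/
noncomputable def drift (U : PolyaUrn q) (x : EuclideanSpace ℝ (Fin q)) (j : Fin q) : ℝ :=
  (U.weight x)⁻¹ * ∑ i, U.intensity j i * x i

theorem measurable_weight (U : PolyaUrn q) : Measurable U.weight := by
  unfold weight; fun_prop

theorem measurable_drift (U : PolyaUrn q) (j : Fin q) : Measurable fun x => U.drift x j := by
  have := U.measurable_weight
  unfold drift; fun_prop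

theorem drift_eq (U : PolyaUrn q) (x : EuclideanSpace ℝ (Fin q)) (j : Fin q) :
    U.drift x j = ∑ i, U.activity i * x i / U.weight x * ∫ v, v j ∂(U.repl i) := by
  rw [drift, Finset.mul_sum]
  refine Finset.sum_congr rfl fun i _ => ?_
  simp only [intensity, Matrix.of_apply]
  ring

/-- Every coordinate of the drift is bounded on the states of a tenable urn. -/
theorem abs_drift_le (U : PolyaUrn q) {x : EuclideanSpace ℝ (Fin q)} (hx : ∀ i, 0 ≤ x i)
    (hw : 0 < U.weight x) (j : Fin q) : |U.drift x j| ≤ ∑ i, |∫ v, v j ∂(U.repl i)| := by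
  rw [drift_eq]
  refine (Finset.abs_sum_le_sum_abs _ _).trans (Finset.sum_le_sum fun i _ => ?_)
  have h0 : 0 ≤ U.activity i * x i := mul_nonneg (U.activity_nonneg i) (hx i)
  have h1 : U.activity i * x i ≤ U.weight x :=
    Finset.single_le_sum (f := fun i => U.activity i * x i)
      (fun i _ => mul_nonneg (U.activity_nonneg i) (hx i)) (Finset.mem_univ i)
  rw [abs_mul, abs_of_nonneg (div_nonneg h0 hw.le)]
  exact mul_le_of_le_one_left (abs_nonneg _) ((div_le_one hw).2 h1)

namespace IsRealization

variable {Ω : Type*} [mΩ : MeasurableSpace Ω] {P : Measure Ω}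
  {X : ℕ → Ω → EuclideanSpace ℝ (Fin q)} {I : ℕ → Ω → Fin q}

theorem urnPast_le (hX : U.IsRealization P X I) (n : ℕ) : urnPast X I n ≤ mΩ :=
  sup_le (iSup₂_le fun k _ => (hX.measurable_state k).comap_le)
    (iSup₂_le fun k _ => (hX.measurable_draw k).comap_le)

theorem measurableSet_draw (hX : U.IsRealization P X I) (n : ℕ) (i : Fin q) :
    MeasurableSet {ω | I n ω = i} := hX.measurable_draw n (measurableSet_singleton i)

theorem measurable_increment (hX : U.IsRealization P X I) (n : ℕ) :
    Measurable fun ω => X (n + 1) ω - X n ω :=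
  (hX.measurable_state (n + 1)).sub (hX.measurable_state n)

variable [IsProbabilityMeasure P]

/-- Integrate the conditional probability over `T`: colour `i` is drawn throughout `T`, so the
conditional law there is the constant `U.repl i`. -/
theorem measure_increment_inter (hX : U.IsRealization P X I) (n : ℕ) (i : Fin q) {T : Set Ω}
    (hT : MeasurableSet[urnPast X I n ⊔ MeasurableSpace.comap (I n) inferInstance] T)
    (hTi : ∀ ω ∈ T, I n ω = i) {B : Set (EuclideanSpace ℝ (Fin q))} (hB : MeasurableSet B) :
    P ({ω | X (n + 1) ω - X n ω ∈ B} ∩ T) = P T * U.repl i B := by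
  have := U.isProbabilityMeasure_repl i
  have hle : urnPast X I n ⊔ MeasurableSpace.comap (I n) inferInstance ≤ mΩ :=
    sup_le (hX.urnPast_le n) (hX.measurable_draw n).comap_le
  have hTm : MeasurableSet T := hle _ hT
  have hBm : MeasurableSet {ω | X (n + 1) ω - X n ω ∈ B} := hX.measurable_increment n hB
  have h1 : ∫ ω in T, {ω | X (n + 1) ω - X n ω ∈ B}.indicator (fun _ => (1 : ℝ)) ω ∂P =
      ∫ ω in T, (U.repl (I n ω)).real B ∂P := by
    rw [← setIntegral_condExp hle ((integrable_const (1 : ℝ)).indicator hBm) hT]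
    exact setIntegral_congr_ae hTm ((hX.replace n B hB).mono fun ω h _ => h)
  have h2 : ∫ ω in T, (U.repl (I n ω)).real B ∂P = P.real T * (U.repl i).real B := by
    rw [setIntegral_congr_fun hTm (g := fun _ => (U.repl i).real B)
      (fun ω hω => by simp only [hTi ω hω])]
    simp
  rw [h2, integral_indicator hBm, Measure.restrict_restrict hBm] at h1
  simp only [integral_const, MeasurableSet.univ, measureReal_restrict_apply, Set.univ_inter,
    smul_eq_mul, mul_one] at h1
  rw [Measure.real, Measure.real, Measure.real, ← ENNReal.toReal_mul] at h1
  exact (ENNReal.toReal_eq_toReal_iff' (measure_ne_top _ _)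
    (ENNReal.mul_ne_top (measure_ne_top _ _) (measure_ne_top _ _))).1 h1

/-- On the event that colour `i` is drawn, the increment is independent of the past. -/
theorem map_prodMk_increment (hX : U.IsRealization P X I) (n : ℕ) (i : Fin q) {S : Ω → ℝ}
    (hS : Measurable[urnPast X I n] S) :
    (P.restrict {ω | I n ω = i}).map (fun ω => (S ω, X (n + 1) ω - X n ω)) =
      ((P.restrict {ω | I n ω = i}).map S).prod (U.repl i) := by
  have := U.isProbabilityMeasure_repl i
  have hS' : Measurable S := hS.mono (hX.urnPast_le n) le_rfl
  have hinc := hX.measurable_increment n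
  refine (Measure.prod_eq fun A B hA hB => ?_).symm
  rw [Measure.map_apply (hS'.prodMk hinc) (hA.prod hB), Measure.map_apply hS' hA,
    Measure.restrict_apply ((hS'.prodMk hinc) (hA.prod hB)), Measure.restrict_apply (hS' hA),
    ← hX.measure_increment_inter n i (T := S ⁻¹' A ∩ {ω | I n ω = i}) ?_ (fun ω h => h.2) hB]
  · congr 1
    ext ω; simp; tauto
  · refine MeasurableSet.inter ?_ ?_
    · exact (le_sup_left : urnPast X I n ≤ _) _ (hS hA)
    · exact (le_sup_right : MeasurableSpace.comap (I n) inferInstance ≤ _) _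
        ⟨{i}, measurableSet_singleton i, rfl⟩

theorem setIntegral_mul_increment (hX : U.IsRealization P X I) (n : ℕ) (i : Fin q) {S : Ω → ℝ}
    (hS : Measurable[urnPast X I n] S) {g : EuclideanSpace ℝ (Fin q) → ℝ} (hg : Measurable g) :
    ∫ ω in {ω | I n ω = i}, S ω * g (X (n + 1) ω - X n ω) ∂P =
      (∫ ω in {ω | I n ω = i}, S ω ∂P) * ∫ v, g v ∂(U.repl i) := by
  have := U.isProbabilityMeasure_repl i
  have hS' : Measurable S := hS.mono (hX.urnPast_le n) le_rfl
  have h1 : ∫ ω in {ω | I n ω = i}, S ω * g (X (n + 1) ω - X n ω) ∂P =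
      ∫ z, z.1 * g z.2 ∂((P.restrict {ω | I n ω = i}).map
        (fun ω => (S ω, X (n + 1) ω - X n ω))) := by
    rw [integral_map (hS'.prodMk (hX.measurable_increment n)).aemeasurable]
    exact (measurable_fst.mul (hg.comp measurable_snd)).aestronglyMeasurable
  rw [h1, hX.map_prodMk_increment n i hS, integral_prod_mul (fun x : ℝ => x) g,
    integral_map (f := fun x : ℝ => x) hS'.aemeasurable aestronglyMeasurable_id]

theorem map_increment (hX : U.IsRealization P X I) (n : ℕ) (i : Fin q) :
    (P.restrict {ω | I n ω = i}).map (fun ω => X (n + 1) ω - X n ω) =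
      P {ω | I n ω = i} • U.repl i := by
  have := U.isProbabilityMeasure_repl i
  have h := congrArg (Measure.map Prod.snd) (hX.map_prodMk_increment n i (S := fun _ => 0)
    measurable_const)
  rw [Measure.map_map measurable_snd (measurable_const.prodMk (hX.measurable_increment n)),
    Measure.map_snd_prod] at h
  simpa [Function.comp_def, Measure.map_apply measurable_const] using h

theorem memLp_increment (hX : U.IsRealization P X I) (n : ℕ) {g : EuclideanSpace ℝ (Fin q) → ℝ}
    {p : ENNReal} (h : ∀ i, MemLp g p (U.repl i)) :
    MemLp (fun ω => g (X (n + 1) ω - X n ω)) p P := by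
  refine memLp_of_forall_restrict_fiber (hX.measurable_draw n) fun i => ?_
  have h1 : MemLp g p ((P.restrict {ω | I n ω = i}).map (fun ω => X (n + 1) ω - X n ω)) := by
    rw [hX.map_increment n i]
    exact (h i).smul_measure (measure_ne_top _ _)
  exact h1.comp_of_map (hX.measurable_increment n).aemeasurable

theorem ae_increment (hX : U.IsRealization P X I) (n : ℕ)
    {p : EuclideanSpace ℝ (Fin q) → Prop}
    (h : ∀ i, ∀ᵐ v ∂(U.repl i), p v) : ∀ᵐ ω ∂P, p (X (n + 1) ω - X n ω) := by
  have key : ∀ i, ∀ᵐ ω ∂P, I n ω = i → p (X (n + 1) ω - X n ω) := by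
    intro i
    refine (ae_restrict_iff' (hX.measurableSet_draw n i)).1 ?_
    refine ae_of_ae_map (hX.measurable_increment n).aemeasurable ?_
    rw [hX.map_increment n i]
    exact Measure.ae_smul_measure (h i) _
  filter_upwards [ae_all_iff.2 key] with ω hω using hω _ rfl

/-- The increment's law is a mixture of the replacement laws; bounding the weights by `1` gives a
bound independent of `n`. -/
theorem integral_increment_le (hX : U.IsRealization P X I) (n : ℕ)
    {g : EuclideanSpace ℝ (Fin q) → ℝ} (hg : Measurable g) (hg0 : ∀ v, 0 ≤ g v)
    (h : ∀ i, Integrable g (U.repl i)) :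
    ∫ ω, g (X (n + 1) ω - X n ω) ∂P ≤ ∑ i, ∫ v, g v ∂(U.repl i) := by
  have hint : Integrable (fun ω => g (X (n + 1) ω - X n ω)) P :=
    memLp_one_iff_integrable.1 (hX.memLp_increment n fun i => memLp_one_iff_integrable.2 (h i))
  rw [integral_eq_sum_fiber (hX.measurable_draw n) hint]
  refine Finset.sum_le_sum fun i _ => ?_
  have := hX.setIntegral_mul_increment n i (S := fun _ => 1) measurable_const hg
  simp only [one_mul] at this
  rw [this]
  refine mul_le_of_le_one_left (integral_nonneg hg0) ?_
  simp [measureReal_le_one]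

/-- The expectation of a function of the past on the event that colour `i` is drawn. -/
theorem setIntegral_draw (hX : U.IsRealization P X I) (n : ℕ) (i : Fin q) {S : Ω → ℝ}
    (hS : Measurable[urnPast X I n] S) (hSi : Integrable S P) :
    Integrable (fun ω => S ω * (U.activity i * X n ω i / U.weight (X n ω))) P ∧
    ∫ ω in {ω | I n ω = i}, S ω ∂P =
      ∫ ω, S ω * (U.activity i * X n ω i / U.weight (X n ω)) ∂P := by
  have hle := hX.urnPast_le n
  have hDi := hX.measurableSet_draw n i
  have e : (S * {ω | I n ω = i}.indicator fun _ => (1 : ℝ)) = {ω | I n ω = i}.indicator S := by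
    ext ω; simp [Set.indicator_apply]
  have h1 := condExp_mul_of_stronglyMeasurable_left (μ := P) (m := urnPast X I n)
    hS.stronglyMeasurable (g := {ω | I n ω = i}.indicator fun _ => (1 : ℝ))
    (by rw [e]; exact hSi.indicator hDi) ((integrable_const (1 : ℝ)).indicator hDi)
  have h2 : P[{ω | I n ω = i}.indicator S | urnPast X I n] =ᵐ[P]
      fun ω => S ω * (U.activity i * X n ω i / U.weight (X n ω)) := by
    rw [e] at h1
    filter_upwards [h1, hX.draw n i] with ω h1 h2
    rw [h1, Pi.mul_apply, h2, weight]
  refine ⟨integrable_condExp.congr h2, ?_⟩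
  rw [← integral_indicator hDi, ← integral_condExp hle]
  exact integral_congr_ae h2

/-- Split by the colour drawn. On each fibre the increment factors out as a replacement mean, and
the draw rule turns the fibre into a weight; the weighted means add up to `drift`. This identifies
`drift` as the conditional mean, tested against past variables. -/
theorem integral_mul_increment (hX : U.IsRealization P X I) (n : ℕ) (j : Fin q) {S : Ω → ℝ}
    (hS : Measurable[urnPast X I n] S) (hSi : Integrable S P)
    (hSX : Integrable (fun ω => S ω * (X (n + 1) ω j - X n ω j)) P) :
    ∫ ω, S ω * (X (n + 1) ω j - X n ω j) ∂P = ∫ ω, S ω * U.drift (X n ω) j ∂P := by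
  rw [integral_eq_sum_fiber (hX.measurable_draw n) hSX]
  simp only [drift_eq, Finset.mul_sum, ← mul_assoc]
  have hi := fun i => hX.setIntegral_draw n i hS hSi
  rw [integral_finsetSum _ fun i _ => (hi i).1.mul_const _]
  refine Finset.sum_congr rfl fun i _ => ?_
  rw [integral_mul_const, ← (hi i).2]
  exact hX.setIntegral_mul_increment n i hS (g := fun v => v j) (by fun_prop)

end IsRealization

end PolyaUrn

/-! ### Noise decomposition of the urn and its centred moments. -/

namespace PolyaUrn

variable {q : ℕ} {U : PolyaUrn q}

theorem HasAllMoments.memLp (hmom : U.HasAllMoments) {p : ℕ} (hp : p ≠ 0) (i j : Fin q) :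
    MemLp (fun v : EuclideanSpace ℝ (Fin q) => v j) p (U.repl i) := by
  have h := hmom p (by exact_mod_cast Nat.one_le_iff_ne_zero.2 hp) i j
  rw [← integrable_norm_rpow_iff (by fun_prop) (by exact_mod_cast hp) (by simp)]
  simpa using h

theorem HasAllMoments.integrable (hmom : U.HasAllMoments) (i j : Fin q) :
    Integrable (fun v : EuclideanSpace ℝ (Fin q) => v j) (U.repl i) :=
  memLp_one_iff_integrable.1 (by exact_mod_cast hmom.memLp one_ne_zero i j)

/-- The activities form a left eigenvector of the intensity matrix. -/
theorem sum_activity_mul_intensity {b : ℝ} (hbal : U.IsBalanced b) (hmom : U.HasAllMoments)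
    (i : Fin q) : ∑ j, U.activity j * U.intensity j i = b * U.activity i := by
  have := U.isProbabilityMeasure_repl i
  have h : ∑ j, U.activity j * ∫ v, v j ∂(U.repl i) = b := by
    simp only [← integral_const_mul]
    rw [← integral_finsetSum _ fun j _ => (hmom.integrable i j).const_mul _,
      integral_congr_ae (hbal.2 i)]
    simp
  rw [← h, Finset.sum_mul]
  refine Finset.sum_congr rfl fun j _ => ?_
  simp only [intensity, Matrix.of_apply]
  ring

theorem sum_activity_mul_drift {b : ℝ} (hbal : U.IsBalanced b) (hmom : U.HasAllMoments)
    {x : EuclideanSpace ℝ (Fin q)} (hx : U.weight x ≠ 0) :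
    ∑ j, U.activity j * U.drift x j = b := by
  have h : ∑ j, U.activity j * ∑ i, U.intensity j i * x i = b * U.weight x := by
    simp only [Finset.mul_sum, weight]
    rw [Finset.sum_comm]
    refine Finset.sum_congr rfl fun i _ => ?_
    rw [← mul_assoc, ← sum_activity_mul_intensity hbal hmom, Finset.sum_mul]
    exact Finset.sum_congr rfl fun j _ => by ring
  calc _ = (U.weight x)⁻¹ * ∑ j, U.activity j * ∑ i, U.intensity j i * x i := by
        rw [Finset.mul_sum]
        exact Finset.sum_congr rfl fun j _ => by rw [drift]; ring
    _ = b := by rw [h]; field_simp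

/-- The martingale difference part of the increment of an urn. -/
noncomputable def noise (U : PolyaUrn q) {Ω : Type*} (X : ℕ → Ω → EuclideanSpace ℝ (Fin q))
    (n : ℕ) (ω : Ω) (j : Fin q) : ℝ :=
  X (n + 1) ω j - X n ω j - U.drift (X n ω) j

/-- The total activity at time `n` of an urn with balance `b`. -/
noncomputable def totalWeight (U : PolyaUrn q) (b : ℝ) (n : ℕ) : ℝ := U.weight U.init + n * b

theorem totalWeight_succ (U : PolyaUrn q) (b : ℝ) (n : ℕ) :
    U.totalWeight b (n + 1) = U.totalWeight b n + b := by
  rw [totalWeight, totalWeight]; push_cast; ring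

/-- The deterministic evolution of the conditional means. -/
noncomputable def propagator (U : PolyaUrn q) (b : ℝ) (k n : ℕ) : Module.End ℝ (Fin q → ℝ) :=
  evolve (Matrix.toLin' U.intensity) (U.totalWeight b) k n

namespace IsRealization

variable {Ω : Type*} [mΩ : MeasurableSpace Ω] {P : Measure Ω}
  {X : ℕ → Ω → EuclideanSpace ℝ (Fin q)} {I : ℕ → Ω → Fin q} {b : ℝ}

theorem ae_abs_drift_le (hten : U.IsTenable P X) (n : ℕ) (j : Fin q) :
    ∀ᵐ ω ∂P, |U.drift (X n ω) j| ≤ ∑ i, |∫ v, v j ∂(U.repl i)| := by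
  filter_upwards [hten n] with ω h using U.abs_drift_le h.1 h.2 j

variable [IsProbabilityMeasure P]

/-- Each increment has activity exactly `b`. Since the denominator of the drift is thus
deterministic, the recursion for the state is linear. -/
theorem ae_weight_eq (hX : U.IsRealization P X I) (hbal : U.IsBalanced b) (n : ℕ) :
    ∀ᵐ ω ∂P, U.weight (X n ω) = U.totalWeight b n := by
  induction n with
  | zero =>
    filter_upwards [hX.start] with ω h
    simp [h, totalWeight]
  | succ n ih =>
    filter_upwards [ih, hX.ae_increment n hbal.2] with ω h1 h2
    rw [totalWeight_succ, ← h1, ← h2, weight, weight, ← Finset.sum_add_distrib]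
    exact Finset.sum_congr rfl fun j _ => by simp; ring

theorem weight_init_pos (hX : U.IsRealization P X I) (hten : U.IsTenable P X) :
    0 < U.weight U.init := by
  obtain ⟨ω, h1, h2⟩ := (hX.start.and (hten 0)).exists
  rw [← h1]; exact h2.2

theorem totalWeight_pos (hX : U.IsRealization P X I) (hbal : U.IsBalanced b)
    (hten : U.IsTenable P X) (n : ℕ) : 0 < U.totalWeight b n := by
  have := hX.weight_init_pos hten
  have := hbal.1
  rw [totalWeight]; positivity

/-- Increment and drift both have activity `b`, so they cancel. The leading eigenvalue therefore
never amplifies the noise. -/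
theorem ae_sum_activity_mul_noise (hX : U.IsRealization P X I) (hbal : U.IsBalanced b)
    (hmom : U.HasAllMoments) (hten : U.IsTenable P X) (n : ℕ) :
    ∀ᵐ ω ∂P, ∑ j, U.activity j * U.noise X n ω j = 0 := by
  filter_upwards [hten n, hX.ae_increment n hbal.2] with ω h1 h2
  simp only [noise, mul_sub, Finset.sum_sub_distrib]
  rw [sum_activity_mul_drift hbal hmom h1.2.ne', ← h2]
  simp [mul_sub]

theorem memLp_state (hX : U.IsRealization P X I) (hmom : U.HasAllMoments) {p : ℕ} (hp : p ≠ 0)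
    (n : ℕ) (j : Fin q) : MemLp (fun ω => X n ω j) p P := by
  induction n with
  | zero =>
    refine (memLp_const (U.init j)).ae_eq ?_
    filter_upwards [hX.start] with ω h
    rw [h]
  | succ n ih =>
    have h := ih.add (hX.memLp_increment n fun i => hmom.memLp hp i j)
    refine h.ae_eq (.of_forall fun ω => ?_)
    simp

theorem memLp_drift (hX : U.IsRealization P X I) (hten : U.IsTenable P X) (p : ENNReal) (n : ℕ)
    (j : Fin q) : MemLp (fun ω => U.drift (X n ω) j) p P :=
  MemLp.of_bound ((U.measurable_drift j).comp (hX.measurable_state n)).aestronglyMeasurable _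
    (ae_abs_drift_le hten n j)

theorem memLp_noise (hX : U.IsRealization P X I) (hmom : U.HasAllMoments)
    (hten : U.IsTenable P X) {p : ℕ} (hp : p ≠ 0) (n : ℕ) (j : Fin q) :
    MemLp (fun ω => U.noise X n ω j) p P :=
  ((hX.memLp_state hmom hp (n + 1) j).sub (hX.memLp_state hmom hp n j)).sub
    (hX.memLp_drift hten p n j)

theorem integral_mul_noise (hX : U.IsRealization P X I) (hten : U.IsTenable P X)
    (n : ℕ) (j : Fin q) {S : Ω → ℝ}
    (hS : Measurable[urnPast X I n] S) (hSi : Integrable S P)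
    (hSn : Integrable (fun ω => S ω * U.noise X n ω j) P) :
    ∫ ω, S ω * U.noise X n ω j ∂P = 0 := by
  have hd : Integrable (fun ω => S ω * U.drift (X n ω) j) P :=
    hSi.mul_bdd ((U.measurable_drift j).comp (hX.measurable_state n)).aestronglyMeasurable
      (ae_abs_drift_le hten n j)
  have e : (fun ω => S ω * U.noise X n ω j) =
      fun ω => S ω * (X (n + 1) ω j - X n ω j) - S ω * U.drift (X n ω) j := by
    ext ω; rw [noise]; ring
  have hi : Integrable (fun ω => S ω * (X (n + 1) ω j - X n ω j)) P := by
    refine (hSn.add hd).congr (.of_forall fun ω => ?_)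
    simp only [Pi.add_apply, noise]; ring
  rw [e, integral_sub hi hd, hX.integral_mul_increment n j hS hSi hi, sub_self]

/-- Tenability makes the draw weights lie in `[0, 1]`, so the drift is bounded; the increment has
moments bounded uniformly in time by those of the replacement vectors. -/
theorem exists_integral_noise_pow_le (hX : U.IsRealization P X I) (hmom : U.HasAllMoments)
    (hten : U.IsTenable P X) (s : ℕ) :
    ∃ D : ℝ, 0 ≤ D ∧ ∀ n, ∫ ω, (∑ j, |U.noise X n ω j|) ^ (2 * s + 2) ∂P ≤ D := by
  set M := ∑ j, ∑ i, |∫ v, v j ∂(U.repl i)|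
  have hM : 0 ≤ M := by positivity
  let g : EuclideanSpace ℝ (Fin q) → ℝ := fun v => (∑ j, |v j| + M) ^ (2 * s + 2)
  have hg0 : ∀ v, 0 ≤ g v := fun v => by positivity
  have hgm : Measurable g := by fun_prop
  have hgi : ∀ i, Integrable g (U.repl i) := by
    intro i
    have := U.isProbabilityMeasure_repl i
    have h : MemLp (fun v : EuclideanSpace ℝ (Fin q) => ∑ j, |v j| + M) (2 * s + 2 : ℕ)
        (U.repl i) :=
      (memLp_finsetSum _ fun j _ => (hmom.memLp (by omega) i j).abs).add (memLp_const M)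
    refine (h.integrable_norm_pow (by omega)).congr (.of_forall fun v => ?_)
    simp only [g]
    rw [Real.norm_of_nonneg (by positivity)]
  refine ⟨∑ i, ∫ v, g v ∂(U.repl i), Finset.sum_nonneg fun i _ => integral_nonneg hg0, fun n => ?_⟩
  refine le_trans ?_ (hX.integral_increment_le n hgm hg0 hgi)
  refine integral_mono_of_nonneg (.of_forall fun ω => by positivity)
    (memLp_one_iff_integrable.1
      (hX.memLp_increment n fun i => memLp_one_iff_integrable.2 (hgi i))) ?_
  filter_upwards [ae_all_iff.2 fun j => ae_abs_drift_le hten n j] with ω h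
  simp only [g, M]
  rw [← Finset.sum_add_distrib]
  gcongr with j
  exact (abs_sub _ _).trans (by simpa using h j)

/-- The state as a linear combination of the noises at the previous times. -/
theorem ae_state_eq (hX : U.IsRealization P X I) (hbal : U.IsBalanced b) (n : ℕ) :
    ∀ᵐ ω ∂P, (fun i => X n ω i) = U.propagator b 0 n (fun i => U.init i) +
      ∑ k ∈ Finset.range n, U.propagator b (k + 1) n (U.noise X k ω) := by
  induction n with
  | zero =>
    filter_upwards [hX.start] with ω h
    simp [h, propagator, evolve]
  | succ n ih =>
    filter_upwards [ih, hX.ae_weight_eq hbal n] with ω h1 h2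
    have e1 : (fun i => X (n + 1) ω i) = (fun i => X n ω i) +
        (U.totalWeight b n)⁻¹ • Matrix.toLin' U.intensity (fun i => X n ω i) +
          U.noise X n ω := by
      ext i
      simp only [noise, drift, Pi.add_apply, Pi.smul_apply, smul_eq_mul, Matrix.toLin'_apply,
        Matrix.mulVec, dotProduct, h2]
      ring
    rw [e1, h1, Finset.sum_range_succ]
    have e2 : U.propagator b (n + 1) (n + 1) = 1 := evolve_of_le _ _ le_rfl
    have e3 : ∀ k ≤ n, ∀ v, U.propagator b k (n + 1) v = U.propagator b k n v +
        (U.totalWeight b n)⁻¹ • Matrix.toLin' U.intensity (U.propagator b k n v) :=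
      fun k hk v => evolve_succ_apply _ _ hk v
    rw [e2, e3 0 (Nat.zero_le n), Finset.sum_congr rfl fun k hk => e3 (k + 1) (by simpa using hk) _,
      Finset.sum_add_distrib, ← Finset.smul_sum, ← map_sum, map_add, smul_add]
    simp only [Module.End.one_apply]
    abel

/-- Bound for the centred even moments of the state, in terms of bounds for the propagator. -/
theorem exists_integral_centred_pow_le (hX : U.IsRealization P X I) (hbal : U.IsBalanced b)
    (hmom : U.HasAllMoments) (hten : U.IsTenable P X) (s : ℕ) :
    ∃ K : ℝ, 0 ≤ K ∧ ∀ (n : ℕ) (i : Fin q) (c : ℕ → ℝ), (∀ k < n, 0 < c k) →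
      (∀ k < n, ∀ y : Fin q → ℝ, ∑ j, U.activity j * y j = 0 →
        |U.propagator b (k + 1) n y i| ≤ c k * ∑ j, |y j|) →
      ∫ ω, (X n ω i - ∫ ω', X n ω' i ∂P) ^ (2 * s + 2) ∂P ≤
        K * (U.totalWeight b n + ∑ k ∈ Finset.range n, c k ^ 2) ^ (s + 1) := by
  obtain ⟨D, hD, hDn⟩ := hX.exists_integral_noise_pow_le hmom hten s
  obtain ⟨K, hK, hKn⟩ := exists_integral_sum_pow_le (P := P) s hD
  refine ⟨K, hK, fun n i c hc hprop => ?_⟩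
  let d : ℕ → Ω → ℝ := fun k ω => U.propagator b (k + 1) n (U.noise X k ω) i
  -- With `n` fixed, `d k` is a combination of noise coordinates with deterministic coefficients;
  -- measurability, integrability and orthogonality are inherited from the noise.
  have hd : ∀ k ω, d k ω =
      ∑ j, U.propagator b (k + 1) n (Pi.single j 1) i * U.noise X k ω j := by
    intro k ω
    have h : U.noise X k ω = ∑ j, U.noise X k ω j • Pi.single j (1 : ℝ) := by
      ext j'; simp [Pi.single_apply]
    simp only [d]
    conv_lhs => rw [h, map_sum, Finset.sum_apply]
    exact Finset.sum_congr rfl fun j _ => by rw [map_smul, Pi.smul_apply, smul_eq_mul, mul_comm]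
  have hdp : ∀ (p : ℕ), p ≠ 0 → ∀ k, MemLp (d k) p P := by
    intro p hp k
    have : d k = fun ω => ∑ j, U.propagator b (k + 1) n (Pi.single j 1) i * U.noise X k ω j :=
      funext (hd k)
    rw [this]
    exact memLp_finsetSum _ fun j _ => (hX.memLp_noise hmom hten hp k j).const_mul _
  have hdi : ∀ k, Integrable (d k) P := fun k =>
    memLp_one_iff_integrable.1 (by exact_mod_cast hdp 1 one_ne_zero k)
  have hnoise_meas : ∀ k j, Measurable[urnPast X I (k + 1)] fun ω => U.noise X k ω j := by
    intro k j
    have h1 := measurable_state_urnPast X I (Nat.le_succ k)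
    have h2 := measurable_state_urnPast X I (le_refl (k + 1))
    have h3 := (U.measurable_drift j).comp h1
    have hc : Measurable fun v : EuclideanSpace ℝ (Fin q) => v j := by fun_prop
    exact ((hc.comp h2).sub (hc.comp h1)).sub h3
  have hS_meas : ∀ k, Measurable[urnPast X I k] fun ω => ∑ m ∈ Finset.range k, d m ω := by
    intro k
    refine Finset.measurable_fun_sum _ fun m hm => ?_
    have : d m = fun ω => ∑ j, U.propagator b (m + 1) n (Pi.single j 1) i * U.noise X m ω j :=
      funext (hd m)
    rw [this]
    refine Finset.measurable_fun_sum _ fun j _ => Measurable.const_mul ?_ _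
    exact (hnoise_meas m j).mono (urnPast_mono X I (Finset.mem_range.1 hm)) le_rfl
  have horth : ∀ (r k : ℕ),
      ∫ ω, (∑ m ∈ Finset.range k, d m ω) ^ r * d k ω ∂P = 0 := by
    intro r k
    have hSp : ∀ p : ℕ, p ≠ 0 → MemLp (fun ω => ∑ m ∈ Finset.range k, d m ω) p P := fun p hp =>
      memLp_finsetSum _ fun m _ => hdp p hp m
    have hnp := fun j => hX.memLp_noise hmom hten (Nat.succ_ne_zero r) k j
    have hint : ∀ j, Integrable
        (fun ω => (∑ m ∈ Finset.range k, d m ω) ^ r * U.noise X k ω j) P := fun j => by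
      simpa using (hSp (r + 1) (by omega)).integrable_pow_mul_pow (a := r) (b := 1) rfl (by omega)
        (hnp j)
    have hintr : Integrable (fun ω => (∑ m ∈ Finset.range k, d m ω) ^ r) P := by
      rcases Nat.eq_zero_or_pos r with rfl | hr
      · simp
      · simpa using (hSp r hr.ne').integrable_pow_mul_pow (a := r) (b := 0) rfl hr.ne' (hSp r hr.ne')
    have e : ∀ ω, (∑ m ∈ Finset.range k, d m ω) ^ r * d k ω =
        ∑ j, U.propagator b (k + 1) n (Pi.single j 1) i *
          ((∑ m ∈ Finset.range k, d m ω) ^ r * U.noise X k ω j) := by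
      intro ω
      rw [hd k ω, Finset.mul_sum]
      exact Finset.sum_congr rfl fun j _ => by ring
    simp only [e]
    rw [integral_finsetSum _ fun j _ => (hint j).const_mul _]
    refine Finset.sum_eq_zero fun j _ => ?_
    rw [integral_const_mul, hX.integral_mul_noise hten k j ((hS_meas k).pow_const r) hintr (hint j),
      mul_zero]
  have hdm : ∀ k < n, ∫ ω, d k ω ^ (2 * s + 2) ∂P ≤ D * c k ^ (2 * s + 2) := by
    intro k hk
    have hsum : MemLp (fun ω => ∑ j, |U.noise X k ω j|) (2 * s + 2 : ℕ) P :=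
      memLp_finsetSum _ fun j _ => (hX.memLp_noise hmom hten (by omega) k j).abs
    have hsi : Integrable (fun ω => (∑ j, |U.noise X k ω j|) ^ (2 * s + 2)) P := by
      simpa using hsum.integrable_pow_mul_pow (a := 2 * s + 2) (b := 0) rfl (by omega) hsum
    calc ∫ ω, d k ω ^ (2 * s + 2) ∂P
        ≤ ∫ ω, c k ^ (2 * s + 2) * (∑ j, |U.noise X k ω j|) ^ (2 * s + 2) ∂P := by
          have hev : Even (2 * s + 2) := ⟨s + 1, by ring⟩
          refine integral_mono_of_nonneg (.of_forall fun ω => hev.pow_nonneg _)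
            (hsi.const_mul _) ?_
          filter_upwards [hX.ae_sum_activity_mul_noise hbal hmom hten k] with ω h
          rw [← mul_pow, ← hev.pow_abs]
          gcongr
          exact hprop k hk _ h
      _ ≤ _ := by
          rw [integral_const_mul, mul_comm]
          have := (hc k hk).le
          gcongr
          exact hDn k
  have hw := hX.totalWeight_pos hbal hten n
  -- The variance process must start at a positive value; the total weight at time `n` is a
  -- convenient one, being only of order `n`.
  have hmain := hKn n d c (fun k => U.totalWeight b n + ∑ m ∈ Finset.range k, c m ^ 2)
    (fun k _ => hdp _ (by omega) k) (fun k _ => horth _ k) hc hdm (by simpa using hw)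
    (fun k _ => by simp only [Finset.sum_range_succ]; linarith)
  refine le_trans (le_of_eq ?_) hmain
  set m₀ := U.propagator b 0 n (fun i => U.init i) i
  have hstate : ∀ᵐ ω ∂P, X n ω i = m₀ + ∑ k ∈ Finset.range n, d k ω := by
    filter_upwards [hX.ae_state_eq hbal n] with ω h
    have := congrFun h i
    simpa [Finset.sum_apply] using this
  have hmean : ∫ ω, X n ω i ∂P = m₀ := by
    -- Exponent `0` in the orthogonality relation says that the differences are centred, so `m₀` is
    -- the mean.
    have h0 : ∀ k, ∫ ω, d k ω ∂P = 0 := fun k => by simpa using horth 0 k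
    rw [integral_congr_ae hstate, integral_add (integrable_const _)
      (integrable_finsetSum _ fun k _ => hdi k), integral_finsetSum _ fun k _ => hdi k]
    simp [h0]
  refine integral_congr_ae ?_
  filter_upwards [hstate] with ω h
  rw [hmean, h, add_sub_cancel_left]

end IsRealization

end PolyaUrn

/-! ### From convergence in distribution to convergence of moments. -/

section

variable {E Ω Ω' : Type*} [TopologicalSpace E] [MeasurableSpace E] [OpensMeasurableSpace E]
  [MeasurableSpace Ω] {P : Measure Ω} [IsProbabilityMeasure P] [MeasurableSpace Ω']

/-- Truncating at level `M` changes an integral by at most the second moment over `M`. -/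
theorem abs_integral_sub_integral_truncate_le {Y : Ω → ℝ} (hY : MemLp Y 2 P) {M : ℝ} (hM : 0 < M) :
    |∫ ω, Y ω ∂P - ∫ ω, max (-M) (min M (Y ω)) ∂P| ≤ (∫ ω, Y ω ^ 2 ∂P) / M := by
  have hi : Integrable Y P := hY.integrable (by norm_num)
  have hb : ∀ y : ℝ, |max (-M) (min M y)| ≤ M := fun y =>
    abs_le.2 ⟨le_max_left _ _, max_le (by linarith) (min_le_left _ _)⟩
  have ht : Integrable (fun ω => max (-M) (min M (Y ω))) P := by
    refine Integrable.of_bound ?_ M (.of_forall fun ω => hb (Y ω))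
    exact aestronglyMeasurable_const.sup (aestronglyMeasurable_const.inf hY.1)
  rw [← integral_sub hi ht, ← integral_div]
  refine (abs_integral_le_integral_abs).trans (integral_mono (hi.sub ht).abs
    (hY.integrable_sq.div_const M) fun ω => ?_)
  simp only
  rw [le_div_iff₀ hM]
  set y := Y ω
  rcases le_total M y with h | h
  · rw [min_eq_left h, max_eq_right (by linarith), abs_of_nonneg (by linarith)]
    nlinarith
  · rw [min_eq_right h]
    rcases le_total (-M) y with h' | h'
    · rw [max_eq_right h']; simp; positivity
    · rw [max_eq_left h', abs_of_nonpos (by linarith)]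
      nlinarith

/-- Convergence in distribution together with bounded second moments of `f (Z n)` implies
convergence of the expectations of `f (Z n)`. -/
theorem MeasureTheory.TendstoInDistribution.tendsto_integral_of_sq_bounded {Q : Measure Ω'}
    [IsProbabilityMeasure Q] {Z : ℕ → Ω → E} {Y : Ω' → E}
    (h : TendstoInDistribution Z atTop Y (fun _ => P) Q) {f : E → ℝ} (hf : Continuous f) {K : ℝ}
    (hZ : ∀ n, MemLp (fun ω => f (Z n ω)) 2 P) (hK : ∀ n, ∫ ω, f (Z n ω) ^ 2 ∂P ≤ K)
    (hY : MemLp (fun ω => f (Y ω)) 2 Q) :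
    Tendsto (fun n => ∫ ω, f (Z n ω) ∂P) atTop (𝓝 (∫ ω, f (Y ω) ∂Q)) := by
  have hK0 : 0 ≤ K := (integral_nonneg fun ω => sq_nonneg _).trans (hK 0)
  set K' := ∫ ω, f (Y ω) ^ 2 ∂Q
  have hK'0 : 0 ≤ K' := integral_nonneg fun ω => sq_nonneg _
  rw [Metric.tendsto_atTop]
  intro ε hε
  -- The truncation errors `K / M` and `K' / M` together stay below `ε / 2`; the `+ 1` makes this
  -- strict and `M` positive.
  set M := 2 * (K + K' + 1) / ε with hMdef
  have hM : 0 < M := by positivity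
  let g : BoundedContinuousFunction E ℝ := BoundedContinuousFunction.ofNormedAddCommGroup
    (fun x => max (-M) (min M (f x))) (by fun_prop) M fun x =>
      abs_le.2 ⟨le_max_left _ _, max_le (by linarith) (min_le_left _ _)⟩
  have hg := ProbabilityMeasure.tendsto_iff_forall_integral_tendsto.1 h.tendsto g
  have hgm : Measurable g := g.continuous.measurable
  have e1 : ∀ n, ∫ x, g x ∂(P.map (Z n)) = ∫ ω, max (-M) (min M (f (Z n ω))) ∂P := fun n =>
    integral_map (h.forall_aemeasurable n) hgm.aestronglyMeasurable
  have e2 : ∫ x, g x ∂(Q.map Y) = ∫ ω, max (-M) (min M (f (Y ω))) ∂Q :=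
    integral_map h.aemeasurable_limit hgm.aestronglyMeasurable
  simp only [ProbabilityMeasure.coe_mk, e1, e2] at hg
  obtain ⟨N, hN⟩ := Metric.tendsto_atTop.1 hg (ε / 2) (half_pos hε)
  refine ⟨N, fun n hn => ?_⟩
  have h1 := abs_integral_sub_integral_truncate_le (hZ n) hM
  have h2 := abs_integral_sub_integral_truncate_le hY hM
  have h3 := hN n hn
  rw [Real.dist_eq] at h3 ⊢
  have h4 : (∫ ω, f (Z n ω) ^ 2 ∂P) / M ≤ K / M := by gcongr; exact hK n
  have h5 : K / M + K' / M < ε / 2 := by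
    rw [← add_div, div_lt_iff₀ hM, hMdef]
    field_simp
    linarith
  rw [abs_le] at h1 h2
  rw [abs_lt] at h3 ⊢
  constructor <;> linarith [h1.1, h1.2, h2.1, h2.2, h3.1, h3.2]

end

section

variable {q : ℕ}

/-- The power mean inequality for the `q + 1` numbers `1` and `|y i|`, indexed by `Option (Fin q)`.
-/
theorem one_add_sum_abs_pow_le (m : ℕ) (y : Fin q → ℝ) :
    (1 + ∑ i, |y i|) ^ (m + 1) ≤ (q + 1 : ℝ) ^ m * (1 + ∑ i, |y i| ^ (m + 1)) := by
  have h := pow_sum_div_card_le_sum_pow (s := (Finset.univ : Finset (Option (Fin q))))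
    (f := fun o => o.elim (1 : ℝ) fun i => |y i|) (fun o _ => by cases o <;> simp) m
  rw [div_le_iff₀ (by simp; positivity), Fintype.sum_option, Fintype.sum_option] at h
  simpa [mul_comm] using h

theorem norm_le_one_add_sum_abs (z : EuclideanSpace ℝ (Fin q)) : ‖z‖ ≤ 1 + ∑ i, |z i| := by
  have h0 : 0 ≤ ∑ i, |z i| := by positivity
  rw [EuclideanSpace.norm_eq]
  refine (Real.sqrt_le_sqrt (y := (∑ i, |z i|) ^ 2) ?_).trans
    (by rw [Real.sqrt_sq h0]; linarith)
  rw [sq, Finset.sum_mul]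
  refine Finset.sum_le_sum fun i _ => ?_
  rw [Real.norm_eq_abs, sq]
  gcongr
  exact Finset.single_le_sum (f := fun i => |z i|) (fun i _ => abs_nonneg _) (Finset.mem_univ i)

variable {Ω : Type*} [MeasurableSpace Ω] {P : Measure Ω} [IsProbabilityMeasure P]

/-- Second moments of a function of polynomial growth. -/
theorem memLp_two_of_abs_le_pow {Y : Ω → EuclideanSpace ℝ (Fin q)} {s : ℕ}
    (hY : ∀ i, MemLp (fun ω => Y ω i) (2 * s + 2 : ℕ) P) {f : EuclideanSpace ℝ (Fin q) → ℝ}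
    (hf : Continuous f) (hfb : ∀ z, |f z| ≤ (1 + ∑ i, |z i|) ^ (s + 1)) :
    MemLp (fun ω => f (Y ω)) 2 P ∧ ∫ ω, f (Y ω) ^ 2 ∂P ≤
      (q + 1 : ℝ) ^ (2 * s + 1) * (1 + ∑ i, ∫ ω, Y ω i ^ (2 * s + 2) ∂P) := by
  have hev : Even (2 * s + 2) := ⟨s + 1, by ring⟩
  have hYm : AEStronglyMeasurable Y P := by
    have : MemLp Y (2 * s + 2 : ℕ) P := MemLp.of_eval_piLp hY
    exact this.1
  have hi : ∀ i, Integrable (fun ω => Y ω i ^ (2 * s + 2)) P := fun i => by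
    simpa using (hY i).integrable_pow_mul_pow (a := 2 * s + 2) (b := 0) rfl (by omega) (hY i)
  have hb : ∀ ω, f (Y ω) ^ 2 ≤
      (q + 1 : ℝ) ^ (2 * s + 1) * (1 + ∑ i, Y ω i ^ (2 * s + 2)) := by
    intro ω
    have h1 := one_add_sum_abs_pow_le (2 * s + 1) fun i => Y ω i
    simp only [hev.pow_abs] at h1
    refine le_trans ?_ h1
    rw [← sq_abs, show 2 * s + 1 + 1 = (s + 1) * 2 by ring, pow_mul]
    gcongr
    exact hfb _
  have hbi : Integrable (fun ω => (q + 1 : ℝ) ^ (2 * s + 1) *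
      (1 + ∑ i, Y ω i ^ (2 * s + 2))) P :=
    ((integrable_const _).add (integrable_finsetSum _ fun i _ => hi i)).const_mul _
  have hfm : AEStronglyMeasurable (fun ω => f (Y ω)) P := hf.comp_aestronglyMeasurable hYm
  constructor
  · rw [memLp_two_iff_integrable_sq hfm]
    refine hbi.mono' (hfm.pow 2) (.of_forall fun ω => ?_)
    rw [Real.norm_of_nonneg (sq_nonneg _)]
    exact hb ω
  · refine (integral_mono_of_nonneg (.of_forall fun ω => sq_nonneg _) hbi
      (.of_forall hb)).trans (le_of_eq ?_)
    rw [integral_const_mul, integral_add (integrable_const _)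
      (integrable_finsetSum _ fun i _ => hi i), integral_finsetSum _ fun i _ => hi i]
    simp

/-- The square of `f` has growth of degree `2 * s + 2`, so bounded coordinate moments of that order
bound `f` in `L²`, which makes truncation uniform in `n`. -/
theorem ExpectationConverges.of_tendstoInDistribution
    {γ : Measure (EuclideanSpace ℝ (Fin q))} [IsGaussian γ]
    {Z : ℕ → Ω → EuclideanSpace ℝ (Fin q)}
    (h : TendstoInDistribution Z atTop id (fun _ => P) γ) {s : ℕ}
    (hZ : ∀ n i, MemLp (fun ω => Z n ω i) (2 * s + 2 : ℕ) P) {K : ℝ}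
    (hK : ∀ n i, ∫ ω, Z n ω i ^ (2 * s + 2) ∂P ≤ K)
    {f : EuclideanSpace ℝ (Fin q) → ℝ} (hf : Continuous f)
    (hfb : ∀ z, |f z| ≤ (1 + ∑ i, |z i|) ^ (s + 1)) : ExpectationConverges P Z γ f := by
  have hγ : ∀ i, MemLp (fun z : EuclideanSpace ℝ (Fin q) => id z i) (2 * s + 2 : ℕ) γ := fun i =>
    (IsGaussian.memLp_id γ _ (ENNReal.natCast_ne_top _)).eval_piLp i
  have h1 := fun n => memLp_two_of_abs_le_pow (hZ n) hf hfb
  have h2 := memLp_two_of_abs_le_pow hγ hf hfb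
  refine ⟨fun n => (h1 n).1.integrable (by norm_num), h2.1.integrable (by norm_num),
    h.tendsto_integral_of_sq_bounded hf (fun n => (h1 n).1)
      (K := (q + 1 : ℝ) ^ (2 * s + 1) * (1 + ∑ _i : Fin q, K)) (fun n => (h1 n).2.trans ?_) h2.1⟩
  gcongr with i
  exact hK n i

/-- Convergence in distribution to a Gaussian law with bounded even moments of all orders implies
convergence of all moments. -/
theorem AllMomentsConverge.of_tendstoInDistribution
    {γ : Measure (EuclideanSpace ℝ (Fin q))} [IsGaussian γ]
    {Z : ℕ → Ω → EuclideanSpace ℝ (Fin q)}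
    (h : TendstoInDistribution Z atTop id (fun _ => P) γ)
    (hZ : ∀ (s n : ℕ) (i : Fin q), MemLp (fun ω => Z n ω i) (2 * s + 2 : ℕ) P)
    (hK : ∀ s : ℕ, ∃ K : ℝ, ∀ n i, ∫ ω, Z n ω i ^ (2 * s + 2) ∂P ≤ K) :
    AllMomentsConverge P Z γ := by
  have key : ∀ (s : ℕ) {f : EuclideanSpace ℝ (Fin q) → ℝ}, Continuous f →
      (∀ z, |f z| ≤ (1 + ∑ i, |z i|) ^ (s + 1)) → ExpectationConverges P Z γ f := by
    intro s f hf hfb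
    obtain ⟨K, hK⟩ := hK s
    exact .of_tendstoInDistribution h (hZ s) hK hf hfb
  have one_le : ∀ z : EuclideanSpace ℝ (Fin q), 1 ≤ 1 + ∑ i, |z i| := fun z => by
    have : 0 ≤ ∑ i, |z i| := by positivity
    linarith
  have abs_le' : ∀ (z : EuclideanSpace ℝ (Fin q)) i, |z i| ≤ 1 + ∑ i, |z i| := fun z i => by
    have := Finset.single_le_sum (f := fun i => |z i|) (fun i _ => abs_nonneg _)
      (Finset.mem_univ i)
    linarith
  have rpow_le : ∀ (p : ℝ) (z : EuclideanSpace ℝ (Fin q)),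
      (1 + ∑ i, |z i|) ^ p ≤ (1 + ∑ i, |z i|) ^ (⌈p⌉₊ + 1) := fun p z => by
    rw [← Real.rpow_natCast]
    refine Real.rpow_le_rpow_of_exponent_le (one_le z) ?_
    push_cast
    linarith [Nat.le_ceil p]
  refine ⟨fun α => ?_, fun r hr => ?_, fun p hp => ?_⟩
  · refine key (∑ i, α i) (by fun_prop) fun z => ?_
    calc |∏ i, z i ^ α i| = ∏ i, |z i| ^ α i := by simp [Finset.abs_prod, abs_pow]
      _ ≤ ∏ i, (1 + ∑ i, |z i|) ^ α i := by
        gcongr with i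
        exact abs_le' z i
      _ = (1 + ∑ i, |z i|) ^ (∑ i, α i) := Finset.prod_pow_eq_pow_sum _ _ _
      _ ≤ _ := pow_le_pow_right₀ (one_le z) (Nat.le_succ _)
  · refine key ⌈∑ i, r i⌉₊ ?_ fun z => ?_
    · refine continuous_finsetProd _ fun i _ => ?_
      exact Continuous.rpow_const (by fun_prop) fun _ => Or.inr (hr i)
    · calc |∏ i, |z i| ^ r i| = ∏ i, |z i| ^ r i := abs_of_nonneg (by positivity)
        _ ≤ ∏ i, (1 + ∑ i, |z i|) ^ r i := by
          gcongr with i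
          · exact hr i
          · exact abs_le' z i
        _ = (1 + ∑ i, |z i|) ^ (∑ i, r i) :=
          (Real.rpow_sum_of_pos (by linarith [one_le z]) _ _).symm
        _ ≤ _ := rpow_le _ z
  · refine key ⌈p⌉₊ ?_ fun z => ?_
    · exact Continuous.rpow_const (by fun_prop) fun _ => Or.inr hp
    · rw [abs_of_nonneg (by positivity)]
      exact (Real.rpow_le_rpow (norm_nonneg z) (norm_le_one_add_sum_abs z) hp).trans (rpow_le _ z)

end

/-! ### Moment convergence for urns, and the two spectral regimes. -/

section

variable {q : ℕ} {Ω : Type*} [MeasurableSpace Ω] {P : Measure Ω}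

theorem normalized_apply {X : ℕ → Ω → EuclideanSpace ℝ (Fin q)} {n : ℕ}
    (hX : ∀ i, Integrable (fun ω => X n ω i) P) (c : ℕ → ℝ) (ω : Ω) (i : Fin q) :
    normalized P X c n ω i = (c n)⁻¹ * (X n ω i - ∫ ω', X n ω' i ∂P) := by
  simp [normalized, eval_integral_piLp hX]

variable [IsProbabilityMeasure P]

namespace PolyaUrn.IsRealization

variable {U : PolyaUrn q} {X : ℕ → Ω → EuclideanSpace ℝ (Fin q)} {I : ℕ → Ω → Fin q} {b : ℝ}

/-- A bound `O(r n)` for the total variance of the noise, propagated to time `n`, gives convergence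
of moments in a central limit theorem with norming `√(r n)`. -/
theorem allMomentsConverge (hX : U.IsRealization P X I) (hbal : U.IsBalanced b)
    (hmom : U.HasAllMoments) (hten : U.IsTenable P X) {r : ℕ → ℝ} (hr : ∀ n, 0 ≤ r n) {K : ℝ}
    (hK : ∀ n, r n ≠ 0 → ∃ c : ℕ → ℝ, (∀ k < n, 0 < c k) ∧
      (∀ k < n, ∀ (i : Fin q) (y : Fin q → ℝ), ∑ j, U.activity j * y j = 0 →
        |U.propagator b (k + 1) n y i| ≤ c k * ∑ j, |y j|) ∧
      U.totalWeight b n + ∑ k ∈ Finset.range n, c k ^ 2 ≤ K * r n)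
    {S : Matrix (Fin q) (Fin q) ℝ} (hS : S.PosSemidef)
    (h : TendstoInDistribution (normalized P X fun n => √(r n)) atTop id (fun _ => P)
      (multivariateGaussian 0 S)) :
    AllMomentsConverge P (normalized P X fun n => √(r n)) (multivariateGaussian 0 S) ∧
      Tendsto (fun n => (r n)⁻¹ • covMatrix P (X n)) atTop (𝓝 S) := by
  have hint : ∀ n i, Integrable (fun ω => X n ω i) P := fun n i =>
    memLp_one_iff_integrable.1 (by exact_mod_cast hX.memLp_state hmom one_ne_zero n i)
  have happ : ∀ n ω i, normalized P X (fun n => √(r n)) n ω i =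
      (√(r n))⁻¹ * (X n ω i - ∫ ω', X n ω' i ∂P) := fun n ω i =>
    normalized_apply (hint n) _ ω i
  have hmoments : AllMomentsConverge P (normalized P X fun n => √(r n))
      (multivariateGaussian 0 S) := by
    refine .of_tendstoInDistribution h (fun s n i => ?_) (fun s => ?_)
    · simp only [happ]
      exact ((hX.memLp_state hmom (by omega) n i).sub (memLp_const _)).const_mul _
    · obtain ⟨L, hL, hLn⟩ := hX.exists_integral_centred_pow_le hbal hmom hten s
      refine ⟨L * |K| ^ (s + 1), fun n i => ?_⟩
      simp only [happ, mul_pow]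
      rw [integral_const_mul]
      -- When the norming vanishes, its inverse is `0` by convention and the normalized vector is
      -- zero, so no variance bound is needed there.
      by_cases h0 : r n = 0
      · rw [h0, Real.sqrt_zero, inv_zero, zero_pow (by omega), zero_mul]
        positivity
      · obtain ⟨c, hc, hprop, hle⟩ := hK n h0
        have hrn : 0 < r n := lt_of_le_of_ne (hr n) (Ne.symm h0)
        have hw := hX.totalWeight_pos hbal hten n
        have hsq : ((√(r n))⁻¹) ^ (2 * s + 2) = ((r n) ^ (s + 1))⁻¹ := by
          rw [show 2 * s + 2 = 2 * (s + 1) by ring, pow_mul, inv_pow, Real.sq_sqrt hrn.le, inv_pow]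
        rw [hsq, inv_mul_le_iff₀ (by positivity)]
        calc _ ≤ L * (U.totalWeight b n + ∑ k ∈ Finset.range n, c k ^ 2) ^ (s + 1) :=
              hLn n i c hc fun k hk y hy => hprop k hk i y hy
          _ ≤ L * (|K| * r n) ^ (s + 1) := by
              gcongr
              exact hle.trans (by gcongr; exact le_abs_self K)
          _ = _ := by ring
  refine ⟨hmoments, tendsto_pi_nhds.2 fun i => tendsto_pi_nhds.2 fun j => ?_⟩
  have hmom2 : ExpectationConverges P (normalized P X fun n => √(r n)) (multivariateGaussian 0 S)
      fun z => z i * z j := by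
    -- Adding the two unit exponents covers the diagonal too: for `i = j` the exponent is `2`.
    have := hmoments.ordinary (Pi.single i 1 + Pi.single j 1)
    have e : (fun z : EuclideanSpace ℝ (Fin q) =>
        ∏ k, z k ^ ((Pi.single i 1 + Pi.single j 1 : Fin q → ℕ) k)) = fun z => z i * z j := by
      ext z
      simp only [Pi.add_apply, pow_add, Finset.prod_mul_distrib]
      simp [Pi.single_apply, pow_ite]
    rwa [e] at this
  have hzero : ∀ k : Fin q, ∫ z : EuclideanSpace ℝ (Fin q), z k ∂(multivariateGaussian 0 S) = 0 := by
    intro k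
    have := eval_integral_piLp (μ := multivariateGaussian 0 S)
      (f := fun z : EuclideanSpace ℝ (Fin q) => z)
      (fun i => IsGaussian.integrable_fun_id.eval_piLp i) k
    rw [← this, integral_id_multivariateGaussian]; rfl
  have hlim : ∫ z : EuclideanSpace ℝ (Fin q), z i * z j ∂(multivariateGaussian 0 S) = S i j := by
    rw [← covariance_eval_multivariateGaussian (μ := 0) hS i j, covariance]
    simp [hzero]
  have := hmom2.2.2
  rw [hlim] at this
  refine this.congr fun n => ?_
  have e : ∀ ω, normalized P X (fun n => √(r n)) n ω i * normalized P X (fun n => √(r n)) n ω j =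
      (r n)⁻¹ * ((X n ω i - ∫ ω', X n ω' i ∂P) * (X n ω j - ∫ ω', X n ω' j ∂P)) := by
    intro ω
    have : (√(r n))⁻¹ * (√(r n))⁻¹ = (r n)⁻¹ := by
      rw [← mul_inv, Real.mul_self_sqrt (hr n)]
    rw [happ, happ, ← this]; ring
  simp only [e]
  rw [integral_const_mul]
  rfl

/-- Bounds for the complex evolution on the nonleading generalized eigenspaces pass to the
propagator. -/
theorem exists_abs_propagator_le (hX : U.IsRealization P X I) (hbal : U.IsBalanced b)
    (hmom : U.HasAllMoments) (hten : U.IsTenable P X) {ev : Fin q → ℂ}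
    (hev : IsEigenvalueList U.intensityC ev) (i₀ : Fin q) (hne : ∀ j, j ≠ i₀ → ev j ≠ b)
    (hb : ev i₀ = b)
    {B : ℕ → ℕ → ℝ} (hB : ∀ k n, 0 < B k n)
    (h : ∀ j, j ≠ i₀ → ∀ v,
      ((Matrix.toLin' U.intensityC - ev j • (1 : Module.End ℂ (Fin q → ℂ))) ^
        (jordanIndex U.intensityC (ev j) + 1)) v = 0 →
      ∃ C, 0 ≤ C ∧ ∀ k n, ‖evolve (Matrix.toLin' U.intensityC)
        (fun j => (U.totalWeight b j : ℂ)) k n v‖ ≤ C * B k n) :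
    ∃ C, 0 < C ∧ ∀ k n (i : Fin q) (y : Fin q → ℝ), ∑ j, U.activity j * y j = 0 →
        |U.propagator b k n y i| ≤ C * B k n * ∑ j, |y j| := by
  have ha : U.activity ≠ 0 := by
    intro h0
    have := hX.weight_init_pos hten
    simp [weight, h0] at this
  obtain ⟨C, hC, hC'⟩ := exists_abs_evolve_le U.intensity ha
    (sum_activity_mul_intensity hbal hmom)
    (hev.finrank_maxGenEigenspace_le_one i₀ hne) (w := U.totalWeight b) (fun k n => (hB k n).le)
    (fun z hz v hv => by
      by_cases hv0 : v = 0
      · exact ⟨0, le_rfl, by simp [hv0]⟩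
      obtain ⟨j, rfl⟩ := hev.exists_eq hv hv0
      exact h j (fun hj => hz (hj ▸ hb)) v (jordanIndex_spec _ _ hv))
  -- The constant is enlarged to be strictly positive, as the martingale inequality requires of its
  -- scales.
  refine ⟨C + 1, by positivity, fun k n i y hy => (hC' y hy k n i).trans ?_⟩
  have := (hB k n).le
  gcongr
  linarith

end PolyaUrn.IsRealization

end

theorem theorem3p2 {q : ℕ} (hq : 2 ≤ q) (U : PolyaUrn q) {b : ℝ} (hbal : U.IsBalanced b)
    (hmom : U.HasAllMoments)
    {Ω : Type*} [MeasurableSpace Ω] (P : Measure Ω) [IsProbabilityMeasure P]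
    (X : ℕ → Ω → EuclideanSpace ℝ (Fin q)) (I : ℕ → Ω → Fin q)
    (hX : U.IsRealization P X I) (hten : U.IsTenable P X)
    (ev : Fin q → ℂ) (hev : IsEigenvalueList U.intensityC ev)
    (hev₁ : ev ⟨0, by omega⟩ = (b : ℂ)) :
    ((ev ⟨1, by omega⟩).re < (ev ⟨0, by omega⟩).re / 2 →
      ∀ S : Matrix (Fin q) (Fin q) ℝ, S.PosSemidef →
        TendstoInDistribution (normalized P X fun n => √(n : ℝ)) atTop id (fun _ => P)
          (multivariateGaussian 0 S) →
        AllMomentsConverge P (normalized P X fun n => √(n : ℝ)) (multivariateGaussian 0 S) ∧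
        Tendsto (fun n : ℕ => (n : ℝ)⁻¹ • covMatrix P (X n)) atTop (𝓝 S)) ∧
    ((ev ⟨1, by omega⟩).re = (ev ⟨0, by omega⟩).re / 2 →
      ∀ S : Matrix (Fin q) (Fin q) ℝ, S.PosSemidef →
        TendstoInDistribution
          (normalized P X fun n =>
            √((n : ℝ) * Real.log n ^ (2 * jordanIndex U.intensityC (ev ⟨1, by omega⟩) + 1)))
          atTop id (fun _ => P) (multivariateGaussian 0 S) →
        AllMomentsConverge P
          (normalized P X fun n =>
            √((n : ℝ) * Real.log n ^ (2 * jordanIndex U.intensityC (ev ⟨1, by omega⟩) + 1)))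
          (multivariateGaussian 0 S) ∧
        Tendsto (fun n : ℕ =>
          ((n : ℝ) * Real.log n ^ (2 * jordanIndex U.intensityC (ev ⟨1, by omega⟩) + 1))⁻¹ •
            covMatrix P (X n)) atTop (𝓝 S)) := by

  have hb := hbal.1
  have hre : (ev ⟨0, by omega⟩).re = b := by rw [hev₁]; simp
  rw [hre]
  have hw := hX.totalWeight_pos hbal hten
  have hstep := U.totalWeight_succ b
  obtain ⟨Q, hQ⟩ := exists_sum_inv_sq_le hw hstep hb
  have hle : ∀ j : Fin q, j ≠ ⟨0, by omega⟩ → (⟨1, by omega⟩ : Fin q) ≤ j := by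
    intro j hj
    rw [Fin.le_def]
    exact Nat.one_le_iff_ne_zero.2 fun h0 => hj (Fin.ext h0)
  have hevle : ∀ j : Fin q, j ≠ ⟨0, by omega⟩ → (ev j).re ≤ (ev ⟨1, by omega⟩).re := fun j hj =>
    hev.re_antitone _ _ (hle j hj)
  -- Simplicity of `b`: all other listed eigenvalues have real part at most `b / 2 < b`.
  have hne : (ev ⟨1, by omega⟩).re ≤ b / 2 → ∀ j : Fin q, j ≠ ⟨0, by omega⟩ → ev j ≠ b := by
    intro h1 j hj h2
    have h3 := hevle j hj
    rw [h2, Complex.ofReal_re] at h3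
    linarith
  have hT := elapsed_nonneg hw
  constructor
  · intro hlt S hS h
    -- A positive rate strictly between `Re λ₂` and `b / 2`: room above `Re λ₂` absorbs all Jordan
    -- blocks, room below `b / 2` keeps the variance linear.
    obtain ⟨ρ, hρ1, hρ2⟩ := exists_between (max_lt hlt (half_pos hb))
    have hρ0 : 0 < ρ := (le_max_right _ _).trans_lt hρ1
    obtain ⟨C, hC, hprop⟩ := hX.exists_abs_propagator_le hbal hmom hten hev ⟨0, by omega⟩
      (hne hlt.le) hev₁ (B := fun k n => Real.exp (ρ * elapsed (U.totalWeight b) k n))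
      (fun k n => Real.exp_pos _) (fun j hj v hv => exists_norm_evolve_le_of_lt hw hQ hρ0
        ((hevle j hj).trans_lt ((le_max_left _ _).trans_lt hρ1)) _ v hv)
    obtain ⟨K, hK, hKn⟩ := exists_variance_sum_le_of_lt hw hstep hb hρ0.le hρ2 C
    refine hX.allMomentsConverge hbal hmom hten (r := fun n => (n : ℝ)) (fun n => n.cast_nonneg)
      (K := K) (fun n hn => ?_) hS h
    have hn1 : 1 ≤ n := Nat.one_le_iff_ne_zero.2 (by exact_mod_cast hn)
    exact ⟨fun k => C * Real.exp (ρ * elapsed (U.totalWeight b) (k + 1) n),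
      fun k _ => by positivity, fun k _ i y hy => hprop (k + 1) n i y hy, hKn n hn1⟩
  · intro heq S hS h
    set ν := jordanIndex U.intensityC (ev ⟨1, by omega⟩) with hν
    obtain ⟨C, hC, hprop⟩ := hX.exists_abs_propagator_le hbal hmom hten hev ⟨0, by omega⟩
      (hne heq.le) hev₁ (B := fun k n => Real.exp (b / 2 * elapsed (U.totalWeight b) k n) *
        (1 + elapsed (U.totalWeight b) k n) ^ ν)
      (fun k n => by have := hT k n; positivity) (fun j hj v hv => by
        -- Below the critical real part the block sizes do not matter; on the critical line the
        -- ordering of the list bounds each index by `ν`.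
        rcases ((hevle j hj).trans_eq heq).lt_or_eq with hlt | heq'
        · obtain ⟨C, hC, hCn⟩ := exists_norm_evolve_le_of_lt hw hQ (half_pos hb) hlt _ v hv
          refine ⟨C, hC, fun k n => (hCn k n).trans ?_⟩
          gcongr
          exact le_mul_of_one_le_right (Real.exp_pos _).le
            (one_le_pow₀ (by linarith [hT k n]))
        · obtain ⟨C, hC, hCn⟩ := exists_norm_evolve_le hw hQ (half_pos hb).le heq'.le _ v hv
          refine ⟨C, hC, fun k n => (hCn k n).trans ?_⟩
          gcongr
          · linarith [hT k n]
          · exact hev.index_antitone _ _ (hle j hj) (heq.trans heq'.symm))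
    obtain ⟨K, hK, hKn⟩ := exists_variance_sum_le_of_eq hw hstep hb ν C
    refine hX.allMomentsConverge hbal hmom hten
      (r := fun n : ℕ => (n : ℝ) * Real.log n ^ (2 * ν + 1)) (fun n => ?_)
      (K := K) (fun n hn => ?_) hS h
    · have := Real.log_natCast_nonneg n
      positivity
    -- The norming vanishes at `n = 0` and, because `log 1 = 0`, at `n = 1`.
    have hn2 : 2 ≤ n := by
      by_contra hn2
      interval_cases n <;> simp at hn
    exact ⟨fun k => C * (Real.exp (b / 2 * elapsed (U.totalWeight b) (k + 1) n) *
        (1 + elapsed (U.totalWeight b) (k + 1) n) ^ ν),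
      fun k _ => by have := hT (k + 1) n; positivity,
      fun k _ i y hy => hprop (k + 1) n i y hy, hKn n hn2⟩
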